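/- An oriented graph is a finite directed graph without loops in which any two vertices are joined by at most one arc; write $V(\overrightarrow{G})$ and $E(\overrightarrow{G})$ for its sets of vertices and of arcs. Pushing a set $S$ of vertices reverses every arc with exactly one end in $S$; two oriented graphs on the same vertex set are push equivalent if one arises from the other by pushing some set of vertices. A pushable homomorphism of $\overrightarrow{G}$ to $\overrightarrow{H}$ is a map $f:V(\overrightarrow{G})\to V(\overrightarrow{H})$ for which there is an oriented graph $\overrightarrow{G}'$ push equivalent to $\overrightarrow{G}$ such that $f(u)f(v)$ is an arc of $\overrightarrow{H}$ for every arc $uv$ of $\overrightarrow{G}'$. An unbalanced $\overrightarrow{C_4}$ is an orientation of the $4$-cycle for which no set of vertices can be pushed so as to obtain equally many forward and backward arcs (that is, one with an odd number of forward arcs; any two of these are isomorphic). An oriented graph $\overrightarrow{G}$ is unbalanced $\overrightarrow{C_4}$-pushable critical if it admits no pushable homomorphism to the unbalanced $\overrightarrow{C_4}$, but each of its proper subgraphs does. Let $\overrightarrow{W}$ be the oriented graph with the seven vertices $v_1,v_2,v_3,v_4,u_1,u_2,u_3$ and the nine arcs $$v_1u_1,\ v_1u_2,\ v_1u_3,\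 u_1v_2,\ v_2u_2,\ u_2v_3,\ v_3u_3,\ v_4u_1,\ u_3v_4.$$ **Theorem.** Let $\overrightarrow{G}$ be an oriented graph whose underlying graph is bipartite. If $\overrightarrow{G}$ is unbalanced $\overrightarrow{C_4}$-pushable critical and is not isomorphic, up to push equivalence, to $\overrightarrow{W}$ (that is, no oriented graph push equivalent to $\overrightarrow{G}$ is isomorphic to $\overrightarrow{W}$), then $$|E(\overrightarrow{G})|\ \ge\ \frac{4\,|V(\overrightarrow{G})|}{3}.$$ -/

import Mathlib

/-- An oriented graph with vertex set `V`: a directed graph without loops and without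
pairs of opposite arcs (asymmetry excludes both), and with at most one arc between two vertices. -/
structure OrientedGraph (V : Type*) where
  Arc : V → V → Prop
  asymm : ∀ u v, Arc u v → ¬ Arc v u

namespace OrientedGraph

variable {V W : Type*}

/-- The underlying simple graph. -/
def underlying (G : OrientedGraph V) : SimpleGraph V where
  Adj u v := G.Arc u v ∨ G.Arc v u
  symm := ⟨fun _ _ h => h.symm⟩
  loopless := ⟨fun v h => h.elim (fun h => G.asymm v v h h) (fun h => G.asymm v v h h)⟩

/-- The number of arcs, which is also the number of edges of the underlying graph. -/
noncomputable def numArcs (G : OrientedGraph V) : ℕ :=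
  {p : V × V | G.Arc p.1 p.2}.ncard

/-- Pushing the set `S`, that is, reversing once for each `s ∈ S` all arcs incident to `s`:
the arcs with exactly one end in `S` are reversed and the others are kept. -/
def push (G : OrientedGraph V) (S : Set V) : OrientedGraph V where
  Arc u v := ((u ∈ S ↔ v ∈ S) ∧ G.Arc u v) ∨ (¬ (u ∈ S ↔ v ∈ S) ∧ G.Arc v u)
  asymm := by
    rintro u v (⟨h, a⟩ | ⟨h, a⟩) (⟨h', b⟩ | ⟨h', b⟩)
    · exact G.asymm _ _ a b
    · exact h' h.symm
    · exact h h'.symm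
    · exact G.asymm _ _ a b

/-- `G'` is obtained from `G` by pushing some set of vertices. -/
def PushEquivalent (G G' : OrientedGraph V) : Prop :=
  ∃ S : Set V, G' = G.push S

/-- `f` is a homomorphism of oriented graphs. -/
def IsHom (G : OrientedGraph V) (H : OrientedGraph W) (f : V → W) : Prop :=
  ∀ u v, G.Arc u v → H.Arc (f u) (f v)

/-- `f` is a pushable homomorphism: a homomorphism to `H` of some graph push equivalent to `G`. -/
def IsPushableHom (G : OrientedGraph V) (H : OrientedGraph W) (f : V → W) : Prop :=
  ∃ G' : OrientedGraph V, G.PushEquivalent G' ∧ G'.IsHom H f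

/-- `G` admits a pushable homomorphism to `H`. -/
def PushablyColorable (G : OrientedGraph V) (H : OrientedGraph W) : Prop :=
  ∃ f : V → W, G.IsPushableHom H f

/-- Isomorphism of oriented graphs. -/
def Isomorphic (G : OrientedGraph V) (H : OrientedGraph W) : Prop :=
  ∃ e : V ≃ W, ∀ u v, G.Arc u v ↔ H.Arc (e u) (e v)

/-- `H`, with vertex set `s ⊆ V`, is a subgraph of `G`. -/
def IsSubgraph (G : OrientedGraph V) (s : Set V) (H : OrientedGraph s) : Prop :=
  ∀ u v : s, H.Arc u v → G.Arc u v

/-- `H`, with vertex set `s ⊆ V`, is a proper subgraph of `G`: a subgraph in which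
some vertex or some arc of `G` is missing. -/
def IsProperSubgraph (G : OrientedGraph V) (s : Set V) (H : OrientedGraph s) : Prop :=
  G.IsSubgraph s H ∧ (s ≠ Set.univ ∨ ∃ u v : s, G.Arc u v ∧ ¬ H.Arc u v)

/-- `G` has no pushable homomorphism to `H`, but all its proper subgraphs have one. -/
def IsPushableCritical (G : OrientedGraph V) (H : OrientedGraph W) : Prop :=
  ¬ G.PushablyColorable H ∧
    ∀ (s : Set V) (K : OrientedGraph s), G.IsProperSubgraph s K → K.PushablyColorable H

/-- `C` is an unbalanced oriented 4-cycle (on the vertices `0, 1, 2, 3` in this cyclic order):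
no set of vertices can be pushed so that the numbers of forward arcs `i → i + 1` and of
backward arcs `i + 1 → i` become equal. -/
def IsUnbalancedFourCycle (C : OrientedGraph (Fin 4)) : Prop :=
  C.underlying = SimpleGraph.cycleGraph 4 ∧
    ∀ S : Set (Fin 4),
      {i : Fin 4 | (C.push S).Arc i (i + 1)}.ncard ≠ {i : Fin 4 | (C.push S).Arc (i + 1) i}.ncard

/-- The exceptional graph on 7 vertices with 9 arcs. The vertices `0, 1, 2, 3` are
`v₁, v₂, v₃, v₄` and the vertices `4, 5, 6` are `u₁, u₂, u₃`. -/
def exceptionalW : OrientedGraph (Fin 7) where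
  Arc a b := (a, b) ∈ ({(0, 4), (0, 5), (0, 6), (4, 1), (1, 5), (5, 2), (2, 6), (3, 4), (6, 3)} :
    Finset (Fin 7 × Fin 7))
  asymm := by decide

end OrientedGraph

/-! Since the graph is bipartite, labelling each arc with the class of its tail turns push
equivalence into switching of a signed graph. The unbalanced 4-cycle becomes K_{2,2} with edge sign
`x * x'`, and a pushable homomorphism becomes a choice of colours `(x, s)` with `s + s' + x * x' =
τ` on every edge of sign `τ` (`pushablyColorable_iff`). In this setting a vertex of degree two
excludes only pairs of end colours with equal first coordinate and one particular sum of second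
coordinates (`Clash`). So it forbids one colour at one end once the other end is coloured. Two
adjacent vertices of degree two can always be coloured, so a critical graph has minimum degree two
and independent degree-two vertices. Suppose there are fewer than `4n/3` edges. Discharging
(`exists_tree_component`) gives a component `K` of the subgraph on vertices of degree at least three
that is a tree of degree-three vertices. Criticality colours everything except `K` and its
degree-two neighbours. Each edge leaving a vertex of `K` is then a tree edge, a forbidden colour
(path to the outside) or a clash (path back into `K`), so at most three constraints meet each
vertex. The core, `IsTreeSystem.solvable_or_exceptional`, is an induction showing that such a system
is always solvable, except on a star with three leaves clashing pairwise in the values forced by the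
centre. A leaf with at most one clash is replaced by forbidden colours. If there is no such leaf and
the clashes form a forest, 2-colour it by first coordinates and solve for the second ones along the
tree. Otherwise a cycle of clashes consists of leaves, and is exchanged for a single clash between
the neighbours of two of them. In the exceptional case the seven vertices involved are already
uncolourable, so by criticality they are the whole graph, and switching turns it into
`exceptionalW`. -/

namespace SignedColoring

/-! ### Colours of the signed 4-cycle -/

/-- A colour `(x, s)`: one of the two vertices of a part of the target, and a switching bit. -/
abbrev Color := ZMod 2 × ZMod 2

/-- The colours `c` and `d` are allowed at the ends of an edge of sign `τ`. -/
def Compatible (τ : ZMod 2) (c d : Color) : Prop := c.2 + d.2 + c.1 * d.1 = τ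

/-- The pair of colours excluded by a path of length two. -/
def Clash (t : ZMod 2) (c d : Color) : Prop := c.1 = d.1 ∧ c.2 + d.2 = t

instance (τ : ZMod 2) (c d : Color) : Decidable (Compatible τ c d) :=
  inferInstanceAs (Decidable (_ = _))

instance (t : ZMod 2) (c d : Color) : Decidable (Clash t c d) :=
  inferInstanceAs (Decidable (_ ∧ _))

theorem Compatible.symm {τ : ZMod 2} {c d : Color} (h : Compatible τ c d) : Compatible τ d c := by
  unfold Compatible at *
  rw [← h]; ring

theorem Clash.symm {t : ZMod 2} {c d : Color} (h : Clash t c d) : Clash t d c :=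
  ⟨h.1.symm, by rw [add_comm]; exact h.2⟩

/-- The colours compatible with `c` form a pair, one for each first coordinate, and different `c`
give different pairs. Hence at most one such pair is contained in `L`. -/
theorem exists_compatible_forall_of_ne (τ : ZMod 2) (L : Finset Color) (hL : L.card ≤ 2) :
    ∃ y : Color, ∀ c, c ≠ y → ∃ d, d ∉ L ∧ Compatible τ d c := by
  revert τ L
  decide

/-- A colour `e` excludes a single `d` by clashing. If `f` is the only other excluded colour, the
choice fails just when `f` and the colour clashing with `e` form the pair compatible with `c`. Only
two pairs contain `f`, so there are two bad `(c, e)`: take `y` from one and `z` from the other. -/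
theorem exists_compatible_not_clash (τ t : ZMod 2) (L : Finset Color) (hL : L.card ≤ 1) :
    ∃ y z : Color, ∀ c e, c ≠ y → e ≠ z → ∃ d, d ∉ L ∧ Compatible τ d c ∧ ¬ Clash t d e := by
  have key : ∀ (τ t : ZMod 2) (f : Color), ∃ y z : Color, ∀ c e, c ≠ y → e ≠ z →
      ∃ d, d ≠ f ∧ Compatible τ d c ∧ ¬ Clash t d e := by decide
  obtain ⟨f, hf⟩ := Finset.card_le_one_iff_subset_singleton.1 hL
  obtain ⟨y, z, h⟩ := key τ t f
  refine ⟨y, z, fun c e hc he => ?_⟩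
  obtain ⟨d, hd, h'⟩ := h c e hc he
  exact ⟨d, fun hdL => hd (Finset.mem_singleton.1 (hf hdL)), h'⟩

/-- There is a colour for the middle vertex of a path of length two whose ends do not clash. -/
theorem exists_compatible_of_not_clash {τ τ' : ZMod 2} {c c' : Color}
    (h : ¬ Clash (τ + τ' + 1) c c') : ∃ d, Compatible τ d c ∧ Compatible τ' d c' := by
  revert τ τ' c c'
  decide

theorem not_clash_of_compatible {τ τ' : ZMod 2} {c c' d : Color}
    (h : Compatible τ d c) (h' : Compatible τ' d c') : ¬ Clash (τ + τ' + 1) c c' := by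
  revert τ τ' c c' d
  decide

/-- A leaf with first coordinate `x` hanging on colour `c` by an edge of sign `τ` has second
coordinate `c.2 + x * c.1 + τ`. The sum for two leaves depends on `x` when `c.1 ≠ c'.1`, and
otherwise it differs from `t` by the hypothesis. -/
theorem exists_fst_not_clash {t τ τ' : ZMod 2} {c c' : Color} (h : ¬ Clash (t + τ + τ') c c') :
    ∃ x : ZMod 2, ¬ (c.2 + x * c.1 + τ + (c'.2 + x * c'.1 + τ') = t) := by
  revert t τ τ' c c'
  decide

/-! ### Forests and connected sets -/

variable {α : Type*}

/-- The vertices of `B` related to `v`. -/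
noncomputable def nbrs (R : α → α → Prop) (B : Finset α) (v : α) : Finset α := by
  classical exact B.filter (R v)

theorem mem_nbrs {R : α → α → Prop} {B : Finset α} {v u : α} :
    u ∈ nbrs R B v ↔ u ∈ B ∧ R v u := by
  simp [nbrs]

theorem nbrs_mono {R R' : α → α → Prop} {B B' : Finset α} {v : α} (hB : B ⊆ B')
    (hR : ∀ u ∈ B, R v u → R' v u) : nbrs R B v ⊆ nbrs R' B' v := fun u hu => by
  rw [mem_nbrs] at hu ⊢
  exact ⟨hB hu.1, hR u hu.1 hu.2⟩

theorem card_nbrs_add_card_nbrs [DecidableEq α] {R : α → α → Prop} {A B C : Finset α}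
    (hA : A ⊆ C) (hB : B ⊆ C) (hAB : Disjoint A B) (v : α) :
    (nbrs R A v).card + (nbrs R B v).card ≤ (nbrs R C v).card := by
  rw [← Finset.card_union_of_disjoint]
  · exact Finset.card_le_card (Finset.union_subset (nbrs_mono hA fun _ _ h => h)
      (nbrs_mono hB fun _ _ h => h))
  · rw [Finset.disjoint_left] at hAB ⊢
    exact fun x hx hx' => hAB (mem_nbrs.1 hx).1 (mem_nbrs.1 hx').1

/-- Every nonempty subset of `S` has a vertex with at most one neighbour in it. -/
def Degenerate (R : α → α → Prop) (S : Finset α) : Prop :=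
  ∀ B ⊆ S, B.Nonempty → ∃ v ∈ B, (nbrs R B v).card ≤ 1

/-- Every nonempty proper subset of `S` is joined to the rest of `S`. -/
def Linked (R : α → α → Prop) (S : Finset α) : Prop :=
  ∀ B ⊆ S, B.Nonempty → B ≠ S → ∃ u ∈ B, ∃ v ∈ S, v ∉ B ∧ R u v

theorem Degenerate.mono {R : α → α → Prop} {S S' : Finset α} (h : Degenerate R S) (hS : S' ⊆ S) :
    Degenerate R S' := fun B hB => h B (hB.trans hS)

theorem zmod_two_add_self (a : ZMod 2) : a + a = 0 := CharTwo.add_self_eq_zero a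

/-- On a degenerate set the sums of a vertex labelling along the edges can be prescribed. -/
theorem Degenerate.exists_potential [DecidableEq α] {R : α → α → Prop}
    (hR : ∀ u v, R u v → R v u) (hirr : ∀ v, ¬ R v v) {τ : α → α → ZMod 2}
    (hτ : ∀ u v, τ u v = τ v u) :
    ∀ S : Finset α, Degenerate R S →
      ∃ g : α → ZMod 2, ∀ u ∈ S, ∀ v ∈ S, R u v → g u + g v = τ u v := by
  intro S
  induction S using Finset.strongInduction with
  | H S ih =>
    intro h
    rcases S.eq_empty_or_nonempty with rfl | hne
    · exact ⟨0, by simp⟩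
    obtain ⟨v, hv, hcard⟩ := h S subset_rfl hne
    obtain ⟨g, hg⟩ := ih (S.erase v) (Finset.erase_ssubset hv) (h.mono (Finset.erase_subset _ _))
    -- As `v` has at most one neighbour in `S`, at most one equation restricts its label.
    have hex : ∃ a : ZMod 2, ∀ u ∈ S, R v u → a + g u = τ v u := by
      rcases (nbrs R S v).eq_empty_or_nonempty with h0 | ⟨w, hw⟩
      · refine ⟨0, fun u hu hvu => ?_⟩
        have : u ∈ nbrs R S v := mem_nbrs.2 ⟨hu, hvu⟩
        simp [h0] at this
      · refine ⟨τ v w + g w, fun u hu hvu => ?_⟩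
        rw [Finset.card_le_one.1 hcard u (mem_nbrs.2 ⟨hu, hvu⟩) w hw, add_assoc,
          zmod_two_add_self, add_zero]
    obtain ⟨a, ha⟩ := hex
    refine ⟨Function.update g v a, fun u hu w hw huw => ?_⟩
    by_cases huv : u = v
    · subst huv
      have hwu : w ≠ u := fun h => hirr u (h ▸ huw)
      simpa [hwu] using ha w hw huw
    · by_cases hwv : w = v
      · subst hwv
        simpa [huv, add_comm, hτ u w] using ha u hu (hR _ _ huw)
      · simpa [huv, hwv] using
          hg u (Finset.mem_erase.2 ⟨huv, hu⟩) w (Finset.mem_erase.2 ⟨hwv, hw⟩) huw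

theorem Linked.exists_adj {R : α → α → Prop} {S : Finset α} (h : Linked R S) {v : α} (hv : v ∈ S)
    (hS : S ≠ {v}) : ∃ u ∈ S, R v u := by
  obtain ⟨u, hu, w, hw, -, huw⟩ :=
    h {v} (by simpa using hv) (Finset.singleton_nonempty v) (Ne.symm hS)
  rw [Finset.mem_singleton] at hu
  exact ⟨w, hw, hu ▸ huw⟩

/-- Deleting vertices that hang on single remaining vertices keeps a set linked. -/
theorem Linked.sdiff_leaves [DecidableEq α] {R : α → α → Prop} (hR : ∀ u v, R u v → R v u)
    {S A : Finset α} (h : Linked R S) (p : α → α)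
    (hp : ∀ a ∈ A, p a ∈ S \ A ∧ ∀ u ∈ S, R a u → u = p a) : Linked R (S \ A) := by
  intro B hB hne hBS
  -- Adding to `B` the deleted leaves that hang on it ensures that an edge leaving the enlarged set
  -- has no deleted end.
  obtain ⟨u, hu, v, hv, hvB, huv⟩ := h (B ∪ (S ∩ A).filter (fun a => p a ∈ B))
    (by
      intro x hx
      simp only [Finset.mem_union, Finset.mem_filter, Finset.mem_inter] at hx
      rcases hx with hx | hx
      · exact (Finset.mem_sdiff.1 (hB hx)).1
      · exact hx.1.1)
    (hne.mono Finset.subset_union_left)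
    (by
      intro heq
      apply hBS
      refine Finset.Subset.antisymm hB fun x hx => ?_
      rw [Finset.mem_sdiff] at hx
      have := heq ▸ hx.1
      simp only [Finset.mem_union, Finset.mem_filter, Finset.mem_inter] at this
      tauto)
  simp only [Finset.mem_union, Finset.mem_filter, Finset.mem_inter, not_or, not_and] at hu hvB
  have hu' : u ∈ B := by
    rcases hu with hu | ⟨⟨-, huA⟩, hpu⟩
    · exact hu
    · have := (hp u huA).2 v hv huv
      exact absurd (this ▸ hpu) hvB.1
  have huA : u ∉ A := (Finset.mem_sdiff.1 (hB hu')).2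
  have huS : u ∈ S := (Finset.mem_sdiff.1 (hB hu')).1
  refine ⟨u, hu', v, Finset.mem_sdiff.2 ⟨hv, fun hvA => ?_⟩, hvB.1, huv⟩
  exact hvB.2 ⟨hv, hvA⟩ ((hp v hvA).2 u huS (hR _ _ huv) ▸ hu')

end SignedColoring

/-! ### Tree systems and the removal of a leaf -/

namespace SignedColoring

variable {α : Type*}

/-- A tree `T` on `S` with forbidden colours `F` and with clash constraints `D`, at most three
edges, forbidden colours and constraints at each vertex. -/
structure IsTreeSystem (T : SimpleGraph α) (S : Finset α) (F : α → Finset Color)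
    (D : α → α → Finset (ZMod 2)) : Prop where
  nonempty : S.Nonempty
  linked : Linked T.Adj S
  degenerate : Degenerate T.Adj S
  D_symm : ∀ u v, D u v = D v u
  D_self : ∀ v, D v v = ∅
  bound : ∀ v ∈ S, (nbrs T.Adj S v).card + (F v).card + ∑ u ∈ S, (D v u).card ≤ 3

/-- There is a colouring of `S` that respects all constraints. -/
def Solvable (T : SimpleGraph α) (σ : α → α → ZMod 2) (S : Finset α) (F : α → Finset Color)
    (D : α → α → Finset (ZMod 2)) : Prop :=
  ∃ φ : α → Color, (∀ v ∈ S, φ v ∉ F v) ∧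
    (∀ u ∈ S, ∀ v ∈ S, T.Adj u v → Compatible (σ u v) (φ u) (φ v)) ∧
    ∀ u ∈ S, ∀ v ∈ S, ∀ t ∈ D u v, ¬ Clash t (φ u) (φ v)

variable {T : SimpleGraph α} {σ : α → α → ZMod 2} {S : Finset α} {F : α → Finset Color}
  {D : α → α → Finset (ZMod 2)}

theorem IsTreeSystem.card_nbrs_pos (h : IsTreeSystem T S F D) {v : α} (hv : v ∈ S)
    (hS : S ≠ {v}) : 0 < (nbrs T.Adj S v).card := by
  obtain ⟨u, hu, huv⟩ := h.linked.exists_adj hv hS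
  exact Finset.card_pos.2 ⟨u, mem_nbrs.2 ⟨hu, huv⟩⟩

theorem IsTreeSystem.solvable_singleton {v : α} (h : IsTreeSystem T {v} F D) :
    Solvable T σ {v} F D := by
  have hb := h.bound v (by simp)
  have hlt : (F v).card < (Finset.univ : Finset Color).card := by
    have : (Finset.univ : Finset Color).card = 4 := by decide
    omega
  obtain ⟨c, -, hc⟩ := Finset.exists_mem_notMem_of_card_lt_card hlt
  refine ⟨fun _ => c, by simpa using hc, fun a ha b hb hab => ?_, fun a ha b hb t ht => ?_⟩
  · rw [Finset.mem_singleton] at ha hb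
    exact absurd hab (by simp [ha, hb])
  · rw [Finset.mem_singleton] at ha hb
    simp [ha, hb, h.D_self] at ht

variable [DecidableEq α]

/-- A star with three leaves whose leaves clash in pairs. -/
def Exceptional (T : SimpleGraph α) (σ : α → α → ZMod 2) (S : Finset α)
    (D : α → α → Finset (ZMod 2)) : Prop :=
  ∃ w u₁ u₂ u₃ : α, u₁ ≠ u₂ ∧ u₁ ≠ u₃ ∧ u₂ ≠ u₃ ∧ S = {w, u₁, u₂, u₃} ∧
    T.Adj w u₁ ∧ T.Adj w u₂ ∧ T.Adj w u₃ ∧ D u₁ u₂ = {σ w u₁ + σ w u₂} ∧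
    D u₁ u₃ = {σ w u₁ + σ w u₃} ∧ D u₂ u₃ = {σ w u₂ + σ w u₃}

theorem two_le_sum_card {v a b : α} (ha : a ∈ S) (hb : b ∈ S) (hab : a ≠ b)
    (hDa : (D v a).Nonempty) (hDb : (D v b).Nonempty) : 2 ≤ ∑ u ∈ S, (D v u).card := by
  have h1 : ∑ u ∈ ({a, b} : Finset α), (D v u).card ≤ ∑ u ∈ S, (D v u).card :=
    Finset.sum_le_sum_of_subset (by
      intro x hx
      simp only [Finset.mem_insert, Finset.mem_singleton] at hx
      rcases hx with rfl | rfl <;> assumption)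
  rw [Finset.sum_pair hab] at h1
  have := hDa.card_pos
  have := hDb.card_pos
  omega

/-- The centre has three tree edges, and each leaf has one tree edge and two clashes. So a system
with a forbidden colour or spare capacity at some vertex is not exceptional, which keeps reductions
out of the exceptional case. -/
theorem Exceptional.tight (h : IsTreeSystem T S F D) (he : Exceptional T σ S D) :
    ∀ v ∈ S, 3 ≤ (nbrs T.Adj S v).card + ∑ u ∈ S, (D v u).card := by
  obtain ⟨w, u₁, u₂, u₃, h12, h13, h23, rfl, hw1, hw2, hw3, d12, d13, d23⟩ := he
  have n12 : (D u₁ u₂).Nonempty := by simp [d12]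
  have n13 : (D u₁ u₃).Nonempty := by simp [d13]
  have n23 : (D u₂ u₃).Nonempty := by simp [d23]
  have n21 := h.D_symm u₁ u₂ ▸ n12
  have n31 := h.D_symm u₁ u₃ ▸ n13
  have n32 := h.D_symm u₂ u₃ ▸ n23
  have leaf : ∀ u a b, T.Adj w u → a ∈ ({w, u₁, u₂, u₃} : Finset α) →
      b ∈ ({w, u₁, u₂, u₃} : Finset α) → a ≠ b → (D u a).Nonempty → (D u b).Nonempty →
      3 ≤ (nbrs T.Adj {w, u₁, u₂, u₃} u).card + ∑ x ∈ {w, u₁, u₂, u₃}, (D u x).card := by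
    intro u a b hwu ha hb hab hDa hDb
    have h1 := two_le_sum_card ha hb hab hDa hDb
    have h2 : 0 < (nbrs T.Adj {w, u₁, u₂, u₃} u).card :=
      Finset.card_pos.2 ⟨w, mem_nbrs.2 ⟨by simp, hwu.symm⟩⟩
    omega
  intro v hv
  have hv' := hv
  simp only [Finset.mem_insert, Finset.mem_singleton] at hv'
  rcases hv' with rfl | rfl | rfl | rfl
  · have h3 : ({u₁, u₂, u₃} : Finset α) ⊆ nbrs T.Adj {v, u₁, u₂, u₃} v := by
      intro x hx
      rw [mem_nbrs]
      refine ⟨Finset.mem_insert_of_mem hx, ?_⟩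
      simp only [Finset.mem_insert, Finset.mem_singleton] at hx
      rcases hx with rfl | rfl | rfl <;> assumption
    have h4 := Finset.card_le_card h3
    rw [Finset.card_eq_three.2 ⟨u₁, u₂, u₃, h12, h13, h23, rfl⟩] at h4
    omega
  · exact leaf _ u₂ u₃ hw1 (by simp) (by simp) h23 n12 n13
  · exact leaf _ u₁ u₃ hw2 (by simp) (by simp) h13 n21 n23
  · exact leaf _ u₁ u₂ hw3 (by simp) (by simp) h12 n31 n32

/-- Removal of a leaf `u` whose effect on the rest is captured by forbidding the colours `Y`. -/
theorem IsTreeSystem.solvable_of_leaf (hσ : ∀ u v, σ u v = σ v u) (h : IsTreeSystem T S F D)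
    {u : α}
    (ih : ∀ F', IsTreeSystem T (S.erase u) F' D →
      Solvable T σ (S.erase u) F' D ∨ Exceptional T σ (S.erase u) D)
    {w : α} (hu : u ∈ S) (hw : w ∈ S) (huw : T.Adj u w) (hleaf : ∀ v ∈ S, T.Adj u v → v = w)
    (Y : α → Finset Color) (hYw : (Y w).Nonempty)
    (hY : ∀ z ∈ S, z ≠ u → (Y z).card ≤ (if z = w then 1 else 0) + (D z u).card)
    (hext : ∀ φ : α → Color, (∀ z ∈ S, z ≠ u → φ z ∉ Y z) → ∃ d, d ∉ F u ∧
      Compatible (σ u w) d (φ w) ∧ ∀ v ∈ S, v ≠ u → ∀ t ∈ D u v, ¬ Clash t d (φ v)) :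
    Solvable T σ S F D := by
  have hwu : w ≠ u := huw.ne'
  -- The new forbidden colours fit in the capacity released by `u`: its tree edge at `w` and its
  -- clashes elsewhere.
  have hsys : IsTreeSystem T (S.erase u) (fun z => F z ∪ Y z) D := by
    refine ⟨⟨w, Finset.mem_erase.2 ⟨hwu, hw⟩⟩, ?_, h.degenerate.mono (Finset.erase_subset _ _),
      h.D_symm, h.D_self, ?_⟩
    · rw [Finset.erase_eq]
      refine h.linked.sdiff_leaves (fun _ _ hab => hab.symm) (fun _ => w) fun a ha => ?_
      rw [Finset.mem_singleton] at ha
      subst ha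
      exact ⟨by simp [hw, hwu], hleaf⟩
    · intro z hz
      have hzu := Finset.ne_of_mem_erase hz
      have hzS := Finset.mem_of_mem_erase hz
      have hb := h.bound z hzS
      have hy := hY z hzS hzu
      rw [← Finset.add_sum_erase S _ hu] at hb
      have hun := Finset.card_union_le (F z) (Y z)
      have hn : (nbrs T.Adj (S.erase u) z).card + (if z = w then 1 else 0) ≤
          (nbrs T.Adj S z).card := by
        split_ifs with hzw
        · have hmem : u ∈ nbrs T.Adj S z := mem_nbrs.2 ⟨hu, hzw ▸ huw.symm⟩
          rw [← Finset.card_erase_add_one hmem]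
          refine Nat.add_le_add_right (Finset.card_le_card fun x hx => ?_) 1
          rw [mem_nbrs, Finset.mem_erase] at hx
          exact Finset.mem_erase.2 ⟨hx.1.1, mem_nbrs.2 ⟨hx.1.2, hx.2⟩⟩
        · exact Finset.card_le_card (nbrs_mono (Finset.erase_subset _ _) fun _ _ h => h)
      omega
  have hwE : w ∈ S.erase u := Finset.mem_erase.2 ⟨hwu, hw⟩
  rcases ih _ hsys with ⟨φ, h1, h2, h3⟩ | hex
  · obtain ⟨d, hd1, hd2, hd3⟩ := hext φ fun z hz hzu hzY =>
      h1 z (Finset.mem_erase.2 ⟨hzu, hz⟩) (Finset.mem_union_right _ hzY)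
    refine ⟨Function.update φ u d, fun v hv => ?_, fun a ha b hb hab => ?_,
      fun a ha b hb t ht => ?_⟩
    · by_cases hvu : v = u
      · subst hvu; simpa using hd1
      · simpa [hvu] using fun hF =>
          h1 v (Finset.mem_erase.2 ⟨hvu, hv⟩) (Finset.mem_union_left _ hF)
    · by_cases hau : a = u
      · subst hau
        have := hleaf b hb hab
        subst this
        simpa [hwu] using hd2
      · by_cases hbu : b = u
        · subst hbu
          have := hleaf a ha hab.symm
          subst this
          rw [hσ]
          simpa [hwu] using hd2.symm
        · simpa [hau, hbu] using
            h2 a (Finset.mem_erase.2 ⟨hau, ha⟩) b (Finset.mem_erase.2 ⟨hbu, hb⟩) hab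
    · by_cases hau : a = u
      · subst hau
        have hba : b ≠ a := fun hba => by simp [hba, h.D_self] at ht
        simpa [hba] using hd3 b hb hba t ht
      · by_cases hbu : b = u
        · subst hbu
          intro hc
          refine hd3 a ha hau t (h.D_symm a b ▸ ht) ?_
          simpa [hau] using hc.symm
        · simpa [hau, hbu] using
            h3 a (Finset.mem_erase.2 ⟨hau, ha⟩) b (Finset.mem_erase.2 ⟨hbu, hb⟩) t ht
  -- A forbidden colour at `w` on top of three other constraints would exceed the bound.
  · have h1 := hex.tight hsys w hwE
    have h2 := hsys.bound w hwE
    have h3 : 0 < (F w ∪ Y w).card := (hYw.mono Finset.subset_union_right).card_pos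
    omega

/-- A leaf with at most one clash constraint can be removed. -/
theorem IsTreeSystem.solvable_of_light_leaf (hσ : ∀ u v, σ u v = σ v u)
    (h : IsTreeSystem T S F D) {u : α}
    (ih : ∀ F', IsTreeSystem T (S.erase u) F' D →
      Solvable T σ (S.erase u) F' D ∨ Exceptional T σ (S.erase u) D)
    {w : α} (hu : u ∈ S) (hw : w ∈ S) (huw : T.Adj u w) (hleaf : ∀ v ∈ S, T.Adj u v → v = w)
    (hD : ∑ v ∈ S, (D u v).card ≤ 1) : Solvable T σ S F D := by
  have hdeg : 0 < (nbrs T.Adj S u).card := Finset.card_pos.2 ⟨w, mem_nbrs.2 ⟨hw, huw⟩⟩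
  have hb := h.bound u hu
  by_cases h0 : ∀ v ∈ S, D u v = ∅
  · obtain ⟨y, hy⟩ := exists_compatible_forall_of_ne (σ u w) (F u) (by omega)
    refine h.solvable_of_leaf hσ ih hu hw huw hleaf (fun z => if z = w then {y} else ∅)
      (by simp) (fun z _ _ => ?_) fun φ hφ => ?_
    · split_ifs <;> simp
    · obtain ⟨d, hd, hc⟩ := hy (φ w) (by simpa using hφ w hw huw.ne')
      exact ⟨d, hd, hc, fun v hv _ t ht => by simp [h0 v hv] at ht⟩
  · push Not at h0
    obtain ⟨v, hv, hne⟩ := h0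
    have hpos : 0 < (D u v).card := hne.card_pos
    rw [← Finset.add_sum_erase S _ hv] at hD hb
    have hrest : ∑ x ∈ S.erase v, (D u x).card = 0 := by omega
    rw [Finset.sum_eq_zero_iff] at hrest
    obtain ⟨t, ht⟩ := Finset.card_eq_one.1 (show (D u v).card = 1 by omega)
    have hvu : v ≠ u := fun hvu => by simp [hvu, h.D_self] at hne
    -- The tree edge is traded for the colour `y` at `w`, and the clash for the colour `z'` at `v`.
    obtain ⟨y, z', hyz⟩ := exists_compatible_not_clash (σ u w) t (F u) (by omega)
    refine h.solvable_of_leaf hσ ih hu hw huw hleaf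
      (fun z => (if z = w then {y} else ∅) ∪ (if z = v then {z'} else ∅))
      (by simp) (fun z _ _ => ?_) fun φ hφ => ?_
    · refine (Finset.card_union_le _ _).trans (Nat.add_le_add ?_ ?_)
      · split_ifs <;> simp
      · split_ifs with hzv
        · rw [hzv, h.D_symm, ht]; simp
        · simp
    · have h1 := hφ w hw huw.ne'
      have h2 := hφ v hv hvu
      simp only [Finset.mem_union, not_or] at h1 h2
      obtain ⟨d, hd, hc, hcl⟩ := hyz (φ w) (φ v) (by simpa using h1.1) (by simpa using h2.2)
      refine ⟨d, hd, hc, fun x hx _ t' ht' => ?_⟩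
      by_cases hxv : x = v
      · subst hxv
        rw [ht, Finset.mem_singleton] at ht'
        exact ht' ▸ hcl
      · have := hrest x (Finset.mem_erase.2 ⟨hxv, hx⟩)
        rw [Finset.card_eq_zero] at this
        simp [this] at ht'

end SignedColoring

/-! ### The clash graph: forests and cycles of leaves -/

namespace SignedColoring

variable {α : Type*} {T : SimpleGraph α} {σ : α → α → ZMod 2} {S : Finset α}
  {F : α → Finset Color} {D : α → α → Finset (ZMod 2)}

theorem card_nbrs_le_sum {B S : Finset α} (hB : B ⊆ S) (v : α) :
    (nbrs (fun a b => (D a b).Nonempty) B v).card ≤ ∑ u ∈ S, (D v u).card := by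
  refine (Finset.card_le_card (nbrs_mono (R' := fun a b => (D a b).Nonempty) hB
    fun _ _ h => h)).trans ?_
  rw [Finset.card_eq_sum_ones]
  refine (Finset.sum_le_sum (g := fun u => (D v u).card) fun u hu => ?_).trans
    (Finset.sum_le_sum_of_subset fun u hu => (mem_nbrs.1 hu).1)
  exact (mem_nbrs.1 hu).2.card_pos

/-- A set that is not degenerate contains a minimal subset of minimum degree at least two. -/
theorem exists_minimal_of_not_degenerate {R : α → α → Prop} (h : ¬ Degenerate R S) :
    ∃ A ⊆ S, A.Nonempty ∧ (∀ v ∈ A, 2 ≤ (nbrs R A v).card) ∧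
      ∀ B ⊂ A, B.Nonempty → ∃ v ∈ B, (nbrs R B v).card ≤ 1 := by
  classical
  unfold Degenerate at h
  push Not at h
  obtain ⟨B₀, hB₀, hne₀, hd₀⟩ := h
  obtain ⟨A, hA, hmin⟩ := Finset.exists_min_image
    (S.powerset.filter fun B => B.Nonempty ∧ ∀ v ∈ B, 1 < (nbrs R B v).card) Finset.card
    ⟨B₀, by simp [hB₀, hne₀]; exact hd₀⟩
  rw [Finset.mem_filter, Finset.mem_powerset] at hA
  refine ⟨A, hA.1, hA.2.1, hA.2.2, fun B hB hne => ?_⟩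
  by_contra! hcon
  have := hmin B (by
    rw [Finset.mem_filter, Finset.mem_powerset]
    exact ⟨hB.subset.trans hA.1, hne, hcon⟩)
  exact absurd (Finset.card_lt_card hB) (by omega)

variable [DecidableEq α]

/-- If the clash constraints form a forest, then the first coordinates can be chosen distinct at
the ends of every constraint, and the second coordinates are found along the tree. -/
theorem IsTreeSystem.solvable_of_degenerate (hσ : ∀ u v, σ u v = σ v u)
    (h : IsTreeSystem T S F D) (hS : ∀ v, S ≠ {v})
    (hheavy : ∀ u ∈ S, (nbrs T.Adj S u).card = 1 → 2 ≤ ∑ v ∈ S, (D u v).card)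
    (hdeg : Degenerate (fun a b => (D a b).Nonempty) S) : Solvable T σ S F D := by
  -- `y` is a proper 2-colouring of the clash forest. A vertex with a forbidden colour has no
  -- clashes, so its `x` can instead avoid the first coordinate of that colour.
  obtain ⟨y, hy⟩ := Degenerate.exists_potential (R := fun a b => (D a b).Nonempty)
    (fun u v huv => h.D_symm u v ▸ huv) (fun v hv => by simp [h.D_self] at hv)
    (τ := fun _ _ => 1) (fun _ _ => rfl) S hdeg
  let x : α → ZMod 2 := fun v => if hv : (F v).Nonempty then 1 + (hv.choose).1 else y v
  -- Once `x` is fixed, compatibility prescribes the sum of second coordinates on each tree edge.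
  obtain ⟨s, hs⟩ := Degenerate.exists_potential (R := T.Adj) (fun _ _ hab => hab.symm)
    (fun v => T.loopless.irrefl v) (τ := fun u v => σ u v + x u * x v)
    (fun u v => by rw [hσ u v, mul_comm]) S h.degenerate
  -- A leaf spends its three constraints on its edge and two clashes. So a forbidden colour occurs
  -- only at a vertex with two tree edges, and nothing else fits there.
  have hF : ∀ v ∈ S, (F v).Nonempty → (F v).card = 1 ∧ ∑ u ∈ S, (D v u).card = 0 := by
    intro v hv hne
    have h1 := h.card_nbrs_pos hv (hS v)
    have h2 := h.bound v hv
    have h3 := hheavy v hv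
    have h4 := hne.card_pos
    omega
  refine ⟨fun v => (x v, s v), fun v hv hmem => ?_, fun u hu v hv huv => ?_,
    fun u hu v hv t ht hc => ?_⟩
  · have hne : (F v).Nonempty := ⟨_, hmem⟩
    have := Finset.card_le_one.1 (hF v hv hne).1.le _ hmem _ hne.choose_spec
    have hx : x v = 1 + (hne.choose).1 := by simp [x, hne]
    rw [← this] at hx
    simp at hx
  · have := hs u hu v hv huv
    unfold Compatible
    simp only
    rw [this, add_assoc, zmod_two_add_self, add_zero]
  · have aux : ∀ a ∈ S, ∀ b ∈ S, t ∈ D a b → x a = y a := by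
      intro a ha b hb hab
      have : ¬ (F a).Nonempty := fun hne => by
        have h0 := (hF a ha hne).2
        rw [Finset.sum_eq_zero_iff] at h0
        have := h0 b hb
        rw [Finset.card_eq_zero] at this
        simp [this] at hab
      simp [x, this]
    have h1 := hy u hu v hv ⟨t, ht⟩
    have h2 := hc.1
    simp only at h2
    rw [aux u hu v hv ht, aux v hv u hu (h.D_symm u v ▸ ht)] at h2
    rw [h2, zmod_two_add_self] at h1
    exact zero_ne_one h1

/-- The vertices of a subset in which every vertex has two clash neighbours are leaves without
forbidden colours and without further constraints. -/
theorem IsTreeSystem.leaves_of_two_le (h : IsTreeSystem T S F D) (hS : ∀ v, S ≠ {v})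
    {A : Finset α} (hAS : A ⊆ S)
    (hA : ∀ v ∈ A, 2 ≤ (nbrs (fun a b => (D a b).Nonempty) A v).card) :
    ∀ v ∈ A, F v = ∅ ∧ (nbrs (fun a b => (D a b).Nonempty) A v).card = 2 ∧
      (∃ p ∈ S \ A, T.Adj v p ∧ ∀ u ∈ S, T.Adj v u → u = p) ∧
      ∀ u ∈ S, (D v u).Nonempty → u ∈ A ∧ (D v u).card = 1 := by
  have basic : ∀ v ∈ A, F v = ∅ ∧ (nbrs (fun a b => (D a b).Nonempty) A v).card = 2 ∧
      (∃ p ∈ S, T.Adj v p ∧ ∀ u ∈ S, T.Adj v u → u = p) ∧ ∑ u ∈ S, (D v u).card = 2 := by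
    intro v hv
    have h1 := h.card_nbrs_pos (hAS hv) (hS v)
    have h2 := h.bound v (hAS hv)
    have h3 := card_nbrs_le_sum (D := D) hAS v
    have h4 := hA v hv
    refine ⟨Finset.card_eq_zero.1 (by omega), by omega, ?_, by omega⟩
    obtain ⟨p, hp⟩ := Finset.card_eq_one.1 (show (nbrs T.Adj S v).card = 1 by omega)
    have hpm : p ∈ nbrs T.Adj S v := by simp [hp]
    rw [mem_nbrs] at hpm
    refine ⟨p, hpm.1, hpm.2, fun u hu huv => ?_⟩
    have : u ∈ nbrs T.Adj S v := mem_nbrs.2 ⟨hu, huv⟩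
    simpa [hp] using this
  intro v hv
  obtain ⟨hF, hcard, ⟨p, hpS, hvp, hp⟩, hsum⟩ := basic v hv
  refine ⟨hF, hcard, ⟨p, Finset.mem_sdiff.2 ⟨hpS, fun hpA => ?_⟩, hvp, hp⟩, fun u hu hne => ?_⟩
  -- If `p` were in `A` too, the two leaves would form all of `S`, leaving room for only one clash
  -- neighbour.
  · obtain ⟨-, -, ⟨q, hqS, hpq, hq⟩, -⟩ := basic p hpA
    have hvq := hq v (hAS hv) hvp.symm
    subst hvq
    have hSeq : ({v, p} : Finset α) = S := by
      by_contra hne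
      obtain ⟨a, ha, b, hb, hbB, hab⟩ := h.linked {v, p} (by
        intro x hx
        simp only [Finset.mem_insert, Finset.mem_singleton] at hx
        rcases hx with rfl | rfl <;> assumption) ⟨v, by simp⟩ hne
      simp only [Finset.mem_insert, Finset.mem_singleton, not_or] at ha hbB
      rcases ha with rfl | rfl
      · exact hbB.2 (hp b hb hab)
      · exact hbB.1 (hq b hb hab)
    have hsub : nbrs (fun a b => (D a b).Nonempty) A v ⊆ {p} := by
      intro x hx
      rw [mem_nbrs] at hx
      have hxS := hAS hx.1
      rw [← hSeq] at hxS
      simp only [Finset.mem_insert, Finset.mem_singleton] at hxS ⊢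
      rcases hxS with rfl | hxS
      · have := hx.2
        simp [h.D_self] at this
      · exact hxS
    have := Finset.card_le_card hsub
    simp at this
    omega
  · rw [← Finset.add_sum_erase S _ hu] at hsum
    have h1 := card_nbrs_le_sum (D := D) (B := A.erase u) (S := S.erase u)
      (Finset.erase_subset_erase u hAS) v
    have h2 : ((nbrs (fun a b => (D a b).Nonempty) A v).erase u).card ≤
        (nbrs (fun a b => (D a b).Nonempty) (A.erase u) v).card :=
      Finset.card_le_card fun x hx => by
        rw [Finset.mem_erase, mem_nbrs] at hx
        exact mem_nbrs.2 ⟨Finset.mem_erase.2 ⟨hx.1, hx.2.1⟩, hx.2.2⟩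
    have h3 := hne.card_pos
    have h4 := Finset.pred_card_le_card_erase (s := nbrs (fun a b => (D a b).Nonempty) A v) (a := u)
    refine ⟨?_, by omega⟩
    by_contra huA
    rw [Finset.erase_eq_of_notMem (fun hmem => huA (mem_nbrs.1 hmem).1)] at h2
    omega

/-- A minimal set of leaves with two clash constraints each can be replaced by one constraint
between the neighbours of two of them. -/
theorem IsTreeSystem.solvable_of_distinct_parents (hσ : ∀ u v, σ u v = σ v u)
    (h : IsTreeSystem T S F D) {A : Finset α} (hAS : A ⊆ S) {p : α → α}
    (hmin : ∀ B ⊂ A, B.Nonempty → ∃ v ∈ B, (nbrs (fun a b => (D a b).Nonempty) B v).card ≤ 1)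
    (hF : ∀ v ∈ A, F v = ∅)
    (hcard : ∀ v ∈ A, (nbrs (fun a b => (D a b).Nonempty) A v).card = 2)
    (hpS : ∀ v ∈ A, p v ∈ S \ A) (hpT : ∀ v ∈ A, T.Adj v (p v))
    (hpu : ∀ v ∈ A, ∀ u ∈ S, T.Adj v u → u = p v)
    (hD : ∀ v ∈ A, ∀ u ∈ S, (D v u).Nonempty → u ∈ A ∧ (D v u).card = 1)
    (ih : ∀ F' D', IsTreeSystem T (S \ A) F' D' →
      Solvable T σ (S \ A) F' D' ∨ Exceptional T σ (S \ A) D')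
    {a b : α} (ha : a ∈ A) (hb : b ∈ A) {t : ZMod 2} (ht : t ∈ D a b) (hab : p a ≠ p b) :
    Solvable T σ S F D := by
  -- By `exists_fst_not_clash`, if the parents avoid a clash of value `τ`, then some common first
  -- coordinate for `a` and `b` avoids their clash of value `t`.
  let τ : ZMod 2 := t + σ a (p a) + σ b (p b)
  let D' : α → α → Finset (ZMod 2) := fun u v =>
    if (u = p a ∧ v = p b) ∨ (u = p b ∧ v = p a) then insert τ (D u v) else D u v
  have hDD' : ∀ u v, D u v ⊆ D' u v := by
    intro u v
    simp only [D']
    split_ifs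
    · exact Finset.subset_insert _ _
    · exact subset_rfl
  have hsplit : ∀ v, (nbrs T.Adj (S \ A) v).card + (nbrs T.Adj A v).card ≤
      (nbrs T.Adj S v).card := by
    exact card_nbrs_add_card_nbrs Finset.sdiff_subset hAS Finset.sdiff_disjoint
  have hsumD' : ∀ v, ∑ u ∈ S \ A, (D' v u).card ≤
      ∑ u ∈ S, (D v u).card + (if v = p a ∨ v = p b then 1 else 0) := by
    intro v
    have h1 : ∀ u ∈ S \ A, (D' v u).card ≤ (D v u).card +
        (if v = p a ∨ v = p b then (if u = (if v = p a then p b else p a) then 1 else 0) else 0) := by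
      intro u _
      simp only [D']
      have hins := Finset.card_insert_le τ (D v u)
      by_cases h1 : v = p a <;> by_cases h2 : v = p b <;> by_cases h3 : u = p a <;>
        by_cases h4 : u = p b <;> simp_all
    refine (Finset.sum_le_sum h1).trans ?_
    rw [Finset.sum_add_distrib]
    refine Nat.add_le_add (Finset.sum_le_sum_of_subset Finset.sdiff_subset) ?_
    by_cases h2 : v = p a ∨ v = p b
    · simp only [if_pos h2]
      generalize (if v = p a then p b else p a) = q
      rw [Finset.sum_ite_eq']
      split <;> simp
    · simp only [if_neg h2, Finset.sum_const_zero, le_refl]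
  have hmemA : ∀ v ∈ A, v ∈ nbrs T.Adj A (p v) := fun v hv => mem_nbrs.2 ⟨hv, (hpT v hv).symm⟩
  have hsys : IsTreeSystem T (S \ A) F D' := by
    refine ⟨⟨p a, hpS a ha⟩, h.linked.sdiff_leaves (fun _ _ hab => hab.symm) p fun v hv =>
      ⟨hpS v hv, hpu v hv⟩, h.degenerate.mono Finset.sdiff_subset, fun u v => ?_, fun v => ?_,
      fun v hv => ?_⟩
    · simp only [D', h.D_symm u v]
      refine if_congr ?_ rfl rfl
      tauto
    · simp only [D', h.D_self]
      rw [if_neg]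
      rintro (⟨h1, h2⟩ | ⟨h1, h2⟩)
      · exact hab (h1 ▸ h2)
      · exact hab (h1 ▸ h2).symm
    · have h1 := h.bound v (Finset.mem_sdiff.1 hv).1
      have h2 := hsplit v
      have h3 := hsumD' v
      -- At each of the two parents, the lost tree edge pays for the new clash.
      have h4 : (if v = p a ∨ v = p b then 1 else 0) ≤ (nbrs T.Adj A v).card := by
        split_ifs with hv
        · rcases hv with rfl | rfl
          · exact Finset.card_pos.2 ⟨a, hmemA a ha⟩
          · exact Finset.card_pos.2 ⟨b, hmemA b hb⟩
        · exact Nat.zero_le _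
      omega
  rcases ih F D' hsys with ⟨φ, h1, h2, h3⟩ | hex
  -- Without the clash `ab` the clash graph on `A` is a forest: proper subsets are handled by
  -- minimality, and in `A` itself `a` keeps one neighbour.
  · obtain ⟨g, hg⟩ := Degenerate.exists_potential
      (R := fun u v => (D u v).Nonempty ∧ ¬ ((u = a ∧ v = b) ∨ (u = b ∧ v = a)))
      (fun u v huv => ⟨h.D_symm u v ▸ huv.1, fun hh => huv.2 (by tauto)⟩)
      (fun v hv => by simp [h.D_self] at hv) (τ := fun _ _ => 1) (fun _ _ => rfl) A (by
        intro B hBA hne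
        rcases hBA.eq_or_ssubset with rfl | hss
        · refine ⟨a, ha, ?_⟩
          have hsub : nbrs (fun u v => (D u v).Nonempty ∧ ¬ ((u = a ∧ v = b) ∨ (u = b ∧ v = a))) B a
              ⊆ (nbrs (fun a b => (D a b).Nonempty) B a).erase b := by
            intro x hx
            rw [mem_nbrs] at hx
            exact Finset.mem_erase.2 ⟨fun hxb => hx.2.2 (Or.inl ⟨rfl, hxb⟩),
              mem_nbrs.2 ⟨hx.1, hx.2.1⟩⟩
          have h5 := Finset.card_le_card hsub
          rw [Finset.card_erase_of_mem (mem_nbrs.2 ⟨hb, ⟨t, ht⟩⟩), hcard a ha] at h5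
          exact h5
        · obtain ⟨v, hv, hvc⟩ := hmin B hss hne
          exact ⟨v, hv, (Finset.card_le_card (nbrs_mono subset_rfl fun _ _ hh => hh.1)).trans hvc⟩)
    obtain ⟨x, hx⟩ := exists_fst_not_clash (t := t) (τ := σ a (p a)) (τ' := σ b (p b))
      (h3 (p a) (hpS a ha) (p b) (hpS b hb) τ (by simp [D']))
    -- The 2-colouring is shifted so that `X a = x`. If `X b = x` as well, the choice of `x`
    -- prevents the clash; otherwise the first coordinates differ.
    let X : α → ZMod 2 := fun v => g v + (x + g a)
    have hXa : X a = x := by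
      simp only [X]
      rw [add_comm x, ← add_assoc, zmod_two_add_self, zero_add]
    let ψ : α → Color := fun v => if v ∈ A then
      (X v, (φ (p v)).2 + X v * (φ (p v)).1 + σ v (p v)) else φ v
    have hψA : ∀ v ∈ A, ψ v = (X v, (φ (p v)).2 + X v * (φ (p v)).1 + σ v (p v)) :=
      fun v hv => by simp [ψ, hv]
    have hψ : ∀ v ∉ A, ψ v = φ v := fun v hv => by simp [ψ, hv]
    have hedge : ∀ v ∈ A, Compatible (σ v (p v)) (ψ v) (ψ (p v)) := by
      intro v hv
      rw [hψA v hv, hψ (p v) (Finset.mem_sdiff.1 (hpS v hv)).2]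
      generalize φ (p v) = c
      generalize X v = y
      generalize σ v (p v) = z
      revert c y z
      decide
    have hclash : ¬ Clash t (ψ a) (ψ b) := by
      intro hc
      rw [hψA a ha, hψA b hb] at hc
      have hXb : X b = x := hc.1.symm.trans hXa
      have hc2 := hc.2
      simp only [hXa, hXb] at hc2
      exact hx hc2
    refine ⟨ψ, fun v hv => ?_, fun u hu v hv huv => ?_, fun u hu v hv t' ht' => ?_⟩
    · by_cases hvA : v ∈ A
      · simp [hF v hvA]
      · rw [hψ v hvA]
        exact h1 v (Finset.mem_sdiff.2 ⟨hv, hvA⟩)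
    · by_cases huA : u ∈ A
      · rw [hpu u huA v hv huv]
        exact hedge u huA
      · by_cases hvA : v ∈ A
        · rw [hpu v hvA u hu huv.symm, hσ]
          exact (hedge v hvA).symm
        · rw [hψ u huA, hψ v hvA]
          exact h2 u (Finset.mem_sdiff.2 ⟨hu, huA⟩) v (Finset.mem_sdiff.2 ⟨hv, hvA⟩) huv
    · by_cases huA : u ∈ A
      · obtain ⟨hvA, hc1⟩ := hD u huA v hv ⟨t', ht'⟩
        by_cases he : (u = a ∧ v = b) ∨ (u = b ∧ v = a)
        · have hone := (hD a ha b (hAS hb) ⟨t, ht⟩).2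
          rcases he with ⟨rfl, rfl⟩ | ⟨rfl, rfl⟩
          · rw [Finset.card_le_one.1 hone.le t' ht' t ht]
            exact hclash
          · rw [h.D_symm] at ht'
            rw [Finset.card_le_one.1 hone.le t' ht' t ht]
            exact fun hc => hclash hc.symm
        · have hguv := hg u huA v hvA ⟨⟨t', ht'⟩, he⟩
          intro hc
          rw [hψA u huA, hψA v hvA] at hc
          have hX : g u = g v := add_right_cancel hc.1
          rw [hX, zmod_two_add_self] at hguv
          exact zero_ne_one hguv
      · by_cases hvA : v ∈ A
        · exact absurd (hD v hvA u hu ⟨t', h.D_symm u v ▸ ht'⟩).1 huA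
        · rw [hψ u huA, hψ v hvA]
          exact h3 u (Finset.mem_sdiff.2 ⟨hu, huA⟩) v (Finset.mem_sdiff.2 ⟨hv, hvA⟩) t'
            (hDD' u v ht')
  -- For a further leaf `c` of the cycle, `p c` loses more tree edges than it gains clashes, so the
  -- reduced system is not tight there.
  · obtain ⟨c, hc, hcb⟩ : ∃ c ∈ nbrs (fun a b => (D a b).Nonempty) A a, c ≠ b := by
      have : 1 < (nbrs (fun a b => (D a b).Nonempty) A a).card := by rw [hcard a ha]; omega
      exact Finset.exists_mem_ne this b
    rw [mem_nbrs] at hc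
    have hca : c ≠ a := fun hh => by
      have := hc.2
      simp [hh, h.D_self] at this
    have h5 := hex.tight hsys (p c) (hpS c hc.1)
    have h6 := h.bound (p c) (Finset.mem_sdiff.1 (hpS c hc.1)).1
    have h7 := hsplit (p c)
    have h8 := hsumD' (p c)
    have h9 : (if p c = p a ∨ p c = p b then 1 else 0) < (nbrs T.Adj A (p c)).card := by
      split_ifs with hv
      · rcases hv with hv | hv
        · exact Finset.one_lt_card.2 ⟨c, hmemA c hc.1, a, hv ▸ hmemA a ha, hca⟩
        · exact Finset.one_lt_card.2 ⟨c, hmemA c hc.1, b, hv ▸ hmemA b hb, hcb⟩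
      · exact Finset.card_pos.2 ⟨c, hmemA c hc.1⟩
    omega

end SignedColoring

/-! ### The star with three leaves, and the induction -/

namespace SignedColoring

variable {α : Type*} [DecidableEq α] {T : SimpleGraph α} {σ : α → α → ZMod 2} {S : Finset α}
  {F : α → Finset Color} {D : α → α → Finset (ZMod 2)}

/-- A star with three leaves and one clash constraint for each pair of leaves. -/
theorem solvable_star_or_exceptional (hσ : ∀ u v, σ u v = σ v u)
    {w u₁ u₂ u₃ : α} {t₁₂ t₁₃ t₂₃ : ZMod 2} (h12 : u₁ ≠ u₂) (h13 : u₁ ≠ u₃) (h23 : u₂ ≠ u₃)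
    (hw1 : T.Adj w u₁) (hw2 : T.Adj w u₂) (hw3 : T.Adj w u₃)
    (hleaf : ∀ u ∈ ({u₁, u₂, u₃} : Finset α), ∀ v ∈ ({w, u₁, u₂, u₃} : Finset α),
      T.Adj u v → v = w)
    (hF : ∀ v ∈ ({w, u₁, u₂, u₃} : Finset α), F v = ∅) (hDs : ∀ u v, D u v = D v u)
    (hDself : ∀ v, D v v = ∅)
    (hDw : ∀ v ∈ ({w, u₁, u₂, u₃} : Finset α), D w v = ∅)
    (d12 : D u₁ u₂ = {t₁₂}) (d13 : D u₁ u₃ = {t₁₃}) (d23 : D u₂ u₃ = {t₂₃}) :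
    Solvable T σ {w, u₁, u₂, u₃} F D ∨ Exceptional T σ {w, u₁, u₂, u₃} D := by
  by_cases hall : t₁₂ = σ w u₁ + σ w u₂ ∧ t₁₃ = σ w u₁ + σ w u₃ ∧ t₂₃ = σ w u₂ + σ w u₃
  · right
    obtain ⟨rfl, rfl, rfl⟩ := hall
    exact ⟨w, u₁, u₂, u₃, h12, h13, h23, rfl, hw1, hw2, hw3, d12, d13, d23⟩
  left
  -- Two of the three first coordinates must agree. With the centre coloured `(0, 0)`, leaf `u` has
  -- second coordinate `σ w u`, so a pair whose clash value is not the sum of its two signs may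
  -- share its first coordinate.
  obtain ⟨x, y, z, k1, k2, k3⟩ : ∃ x y z : ZMod 2, ¬ (x = y ∧ σ w u₁ + σ w u₂ = t₁₂) ∧
      ¬ (x = z ∧ σ w u₁ + σ w u₃ = t₁₃) ∧ ¬ (y = z ∧ σ w u₂ + σ w u₃ = t₂₃) := by
    rw [not_and_or, not_and_or] at hall
    rcases hall with hall | hall | hall
    · exact ⟨0, 0, 1, fun hh => hall hh.2.symm, fun hh => zero_ne_one hh.1,
        fun hh => zero_ne_one hh.1⟩
    · exact ⟨0, 1, 0, fun hh => zero_ne_one hh.1, fun hh => hall hh.2.symm,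
        fun hh => one_ne_zero hh.1⟩
    · exact ⟨1, 0, 0, fun hh => one_ne_zero hh.1, fun hh => one_ne_zero hh.1,
        fun hh => hall hh.2.symm⟩
  let φ : α → Color := fun v =>
    if v = w then (0, 0) else (if v = u₁ then x else if v = u₂ then y else z, σ w v)
  have φw : φ w = (0, 0) := by simp [φ]
  have φ1 : φ u₁ = (x, σ w u₁) := by simp [φ, hw1.ne']
  have φ2 : φ u₂ = (y, σ w u₂) := by simp [φ, hw2.ne', h12.symm]
  have φ3 : φ u₃ = (z, σ w u₃) := by simp [φ, hw3.ne', h13.symm, h23.symm]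
  have hedge : ∀ u ∈ ({u₁, u₂, u₃} : Finset α), Compatible (σ w u) (φ w) (φ u) := by
    intro u hu
    have : u ≠ w := by
      simp only [Finset.mem_insert, Finset.mem_singleton] at hu
      rcases hu with rfl | rfl | rfl
      exacts [hw1.ne', hw2.ne', hw3.ne']
    simp [φ, this, Compatible]
  refine ⟨φ, fun v hv => by simp [hF v hv], fun u hu v hv huv => ?_, fun u hu v hv t ht => ?_⟩
  · rcases Finset.mem_insert.1 hu with rfl | hu'
    · rcases Finset.mem_insert.1 hv with rfl | hv'
      · exact absurd huv (T.loopless.irrefl _)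
      · exact hedge v hv'
    · rw [hleaf u hu' v hv huv, hσ]
      exact (hedge u hu').symm
  · rcases Finset.mem_insert.1 hu with rfl | hu'
    · simp [hDw v hv] at ht
    rcases Finset.mem_insert.1 hv with rfl | hv'
    · rw [hDs] at ht
      simp [hDw u hu] at ht
    simp only [Finset.mem_insert, Finset.mem_singleton] at hu' hv'
    have c12 : ∀ t ∈ D u₁ u₂, ¬ Clash t (φ u₁) (φ u₂) := by
      simpa [d12, φ1, φ2, Clash] using k1
    have c13 : ∀ t ∈ D u₁ u₃, ¬ Clash t (φ u₁) (φ u₃) := by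
      simpa [d13, φ1, φ3, Clash] using k2
    have c23 : ∀ t ∈ D u₂ u₃, ¬ Clash t (φ u₂) (φ u₃) := by
      simpa [d23, φ2, φ3, Clash] using k3
    rcases hu' with rfl | rfl | rfl <;> rcases hv' with rfl | rfl | rfl
    · simp [hDself] at ht
    · exact c12 t ht
    · exact c13 t ht
    · exact fun hc => c12 t (hDs _ _ ▸ ht) hc.symm
    · simp [hDself] at ht
    · exact c23 t ht
    · exact fun hc => c13 t (hDs _ _ ▸ ht) hc.symm
    · exact fun hc => c23 t (hDs _ _ ▸ ht) hc.symm
    · simp [hDself] at ht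

/-- A minimal set of leaves with two clash constraints each, all constraints joining leaves with
the same neighbour, is found only in a star. -/
theorem IsTreeSystem.solvable_or_exceptional_of_common_parent (hσ : ∀ u v, σ u v = σ v u)
    (h : IsTreeSystem T S F D) {A : Finset α} (hAS : A ⊆ S) (hne : A.Nonempty) {p : α → α}
    (hcard : ∀ v ∈ A, (nbrs (fun a b => (D a b).Nonempty) A v).card = 2)
    (hpS : ∀ v ∈ A, p v ∈ S \ A) (hpT : ∀ v ∈ A, T.Adj v (p v))
    (hpu : ∀ v ∈ A, ∀ u ∈ S, T.Adj v u → u = p v)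
    (hD : ∀ v ∈ A, ∀ u ∈ S, (D v u).Nonempty → u ∈ A ∧ (D v u).card = 1)
    (hpp : ∀ a ∈ A, ∀ b ∈ A, (D a b).Nonempty → p a = p b) :
    Solvable T σ S F D ∨ Exceptional T σ S D := by
  obtain ⟨u₁, hu1⟩ := hne
  obtain ⟨u₂, u₃, h23, hN⟩ := Finset.card_eq_two.1 (hcard u₁ hu1)
  have hm : ∀ v, v ∈ nbrs (fun a b => (D a b).Nonempty) A u₁ ↔ v = u₂ ∨ v = u₃ := by
    intro v; simp [hN]
  obtain ⟨hu2, n12⟩ := mem_nbrs.1 ((hm u₂).2 (Or.inl rfl))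
  obtain ⟨hu3, n13⟩ := mem_nbrs.1 ((hm u₃).2 (Or.inr rfl))
  have h12 : u₁ ≠ u₂ := fun hh => by simp [← hh, h.D_self] at n12
  have h13 : u₁ ≠ u₃ := fun hh => by simp [← hh, h.D_self] at n13
  have p2 : p u₂ = p u₁ := (hpp u₁ hu1 u₂ hu2 n12).symm
  have p3 : p u₃ = p u₁ := (hpp u₁ hu1 u₃ hu3 n13).symm
  obtain ⟨hwS, hwA⟩ := Finset.mem_sdiff.1 (hpS u₁ hu1)
  have hw1 := (hpT u₁ hu1).symm
  have hw2 := p2 ▸ (hpT u₂ hu2).symm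
  have hw3 := p3 ▸ (hpT u₃ hu3).symm
  have q1 := hpu u₁ hu1
  have q2 := p2 ▸ hpu u₂ hu2
  have q3 := p3 ▸ hpu u₃ hu3
  generalize p u₁ = w at *
  have hthree : ({u₁, u₂, u₃} : Finset α).card = 3 :=
    Finset.card_eq_three.2 ⟨u₁, u₂, u₃, h12, h13, h23, rfl⟩
  have hsub : ({u₁, u₂, u₃} : Finset α) ⊆ nbrs T.Adj S w := by
    intro x hx
    simp only [Finset.mem_insert, Finset.mem_singleton] at hx
    rcases hx with rfl | rfl | rfl
    exacts [mem_nbrs.2 ⟨hAS hu1, hw1⟩, mem_nbrs.2 ⟨hAS hu2, hw2⟩, mem_nbrs.2 ⟨hAS hu3, hw3⟩]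
  have hbw := h.bound w hwS
  have hle := Finset.card_le_card hsub
  -- The bound three at `w` leaves no further neighbour, so connectedness makes the star all of `S`.
  have hNw : ({u₁, u₂, u₃} : Finset α) = nbrs T.Adj S w :=
    Finset.eq_of_subset_of_card_le hsub (by omega)
  have hSeq : ({w, u₁, u₂, u₃} : Finset α) = S := by
    by_contra hneq
    obtain ⟨a, ha, b, hb, hbB, hab⟩ := h.linked {w, u₁, u₂, u₃} (by
      intro x hx
      simp only [Finset.mem_insert, Finset.mem_singleton] at hx
      rcases hx with rfl | rfl | rfl | rfl
      exacts [hwS, hAS hu1, hAS hu2, hAS hu3]) ⟨w, by simp⟩ hneq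
    simp only [Finset.mem_insert, Finset.mem_singleton] at ha
    rcases ha with rfl | rfl | rfl | rfl
    · have : b ∈ nbrs T.Adj S a := mem_nbrs.2 ⟨hb, hab⟩
      rw [← hNw] at this
      exact hbB (Finset.mem_insert_of_mem this)
    · exact hbB (by simp [q1 b hb hab])
    · exact hbB (by simp [q2 b hb hab])
    · exact hbB (by simp [q3 b hb hab])
  have hDw : ∀ v ∈ S, D w v = ∅ := by
    have h0 : ∑ u ∈ S, (D w u).card = 0 := by omega
    rw [Finset.sum_eq_zero_iff] at h0
    exact fun v hv => Finset.card_eq_zero.1 (h0 v hv)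
  have n23 : (D u₂ u₃).Nonempty := by
    by_contra hemp
    have hsub2 : nbrs (fun a b => (D a b).Nonempty) A u₂ ⊆ {u₁} := by
      intro x hx
      rw [mem_nbrs] at hx
      have hxS := hAS hx.1
      rw [← hSeq] at hxS
      simp only [Finset.mem_insert, Finset.mem_singleton] at hxS ⊢
      rcases hxS with rfl | rfl | rfl | rfl
      · exact absurd hx.1 hwA
      · rfl
      · have := hx.2
        simp [h.D_self] at this
      · exact absurd hx.2 hemp
    have := Finset.card_le_card hsub2
    rw [hcard u₂ hu2] at this
    simp at this
  obtain ⟨t₁₂, d12⟩ := Finset.card_eq_one.1 (hD u₁ hu1 u₂ (hAS hu2) n12).2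
  obtain ⟨t₁₃, d13⟩ := Finset.card_eq_one.1 (hD u₁ hu1 u₃ (hAS hu3) n13).2
  obtain ⟨t₂₃, d23⟩ := Finset.card_eq_one.1 (hD u₂ hu2 u₃ (hAS hu3) n23).2
  have hFl : ∀ u ∈ A, F u = ∅ := by
    intro u hu
    have b1 := h.bound u (hAS hu)
    have b2 := card_nbrs_le_sum (D := D) hAS u
    have b3 : 0 < (nbrs T.Adj S u).card :=
      Finset.card_pos.2 ⟨p u, mem_nbrs.2 ⟨(Finset.mem_sdiff.1 (hpS u hu)).1, hpT u hu⟩⟩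
    rw [hcard u hu] at b2
    exact Finset.card_eq_zero.1 (by omega)
  subst hSeq
  refine solvable_star_or_exceptional hσ h12 h13 h23 hw1 hw2 hw3 (fun u hu v hv huv => ?_)
    (fun v hv => ?_) h.D_symm h.D_self hDw d12 d13 d23
  · simp only [Finset.mem_insert, Finset.mem_singleton] at hu
    rcases hu with rfl | rfl | rfl
    exacts [q1 v hv huv, q2 v hv huv, q3 v hv huv]
  · simp only [Finset.mem_insert, Finset.mem_singleton] at hv
    rcases hv with rfl | rfl | rfl | rfl
    exacts [Finset.card_eq_zero.1 (by omega), hFl _ hu1, hFl _ hu2, hFl _ hu3]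

/-- Every tree system is solvable, except for the star with three pairwise clashing leaves. -/
theorem IsTreeSystem.solvable_or_exceptional (hσ : ∀ u v, σ u v = σ v u)
    (h : IsTreeSystem T S F D) : Solvable T σ S F D ∨ Exceptional T σ S D := by
  induction S using Finset.strongInduction generalizing F D with
  | H S ih =>
    by_cases hsing : ∃ v, S = {v}
    · obtain ⟨v, rfl⟩ := hsing
      exact Or.inl h.solvable_singleton
    push Not at hsing
    by_cases hlight : ∃ u ∈ S, (nbrs T.Adj S u).card = 1 ∧ ∑ v ∈ S, (D u v).card ≤ 1
    · obtain ⟨u, hu, h1, h2⟩ := hlight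
      obtain ⟨w, hw⟩ := Finset.card_eq_one.1 h1
      have hm : ∀ v, v ∈ nbrs T.Adj S u ↔ v = w := by intro v; simp [hw]
      obtain ⟨hwS, huw⟩ := mem_nbrs.1 ((hm w).2 rfl)
      exact Or.inl (h.solvable_of_light_leaf hσ
        (fun F' hF' => ih _ (Finset.erase_ssubset hu) hF') hu hwS huw
        (fun v hv huv => (hm v).1 (mem_nbrs.2 ⟨hv, huv⟩)) h2)
    push Not at hlight
    by_cases hdeg : Degenerate (fun a b => (D a b).Nonempty) S
    · exact Or.inl (h.solvable_of_degenerate hσ hsing hlight hdeg)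
    obtain ⟨A, hAS, hne, hA2, hmin⟩ := exists_minimal_of_not_degenerate hdeg
    have hA := h.leaves_of_two_le hsing hAS hA2
    choose! p hp using fun v hv => (hA v hv).2.2.1
    by_cases hpp : ∀ a ∈ A, ∀ b ∈ A, (D a b).Nonempty → p a = p b
    · exact h.solvable_or_exceptional_of_common_parent hσ hAS hne (fun v hv => (hA v hv).2.1)
        (fun v hv => (hp v hv).1) (fun v hv => (hp v hv).2.1) (fun v hv => (hp v hv).2.2)
        (fun v hv => (hA v hv).2.2.2) hpp
    · push Not at hpp
      obtain ⟨a, ha, b, hb, ⟨t, ht⟩, hab⟩ := hpp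
      exact Or.inl (h.solvable_of_distinct_parents hσ hAS hmin (fun v hv => (hA v hv).1)
        (fun v hv => (hA v hv).2.1)
        (fun v hv => (hp v hv).1) (fun v hv => (hp v hv).2.1) (fun v hv => (hp v hv).2.2)
        (fun v hv => (hA v hv).2.2.2)
        (fun F' D' h' => ih _ (Finset.sdiff_ssubset hAS hne) h') ha hb ht hab)

end SignedColoring

/-! ### Edge counting and discharging -/

namespace SignedColoring

section Counting

variable {α : Type*} {R : α → α → Prop}

theorem sum_card_nbrs_comm (hR : ∀ u v, R u v → R v u) (s t : Finset α) :
    ∑ a ∈ s, (nbrs R t a).card = ∑ b ∈ t, (nbrs R s b).card := by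
  classical
  have h := Finset.sum_card_bipartiteAbove_eq_sum_card_bipartiteBelow R (s := s) (t := t)
  refine Eq.trans (Finset.sum_congr rfl fun a _ => ?_)
    (h.trans (Finset.sum_congr rfl fun b _ => ?_))
  · congr 1
  · congr 1
    ext x
    simp only [mem_nbrs, Finset.mem_bipartiteBelow]
    exact and_congr_right fun _ => ⟨hR _ _, hR _ _⟩

/-- Growing `B` to the linked set `K` adds at least one edge for each new vertex. -/
theorem Linked.sum_card_nbrs_le [DecidableEq α] (hR : ∀ u v, R u v → R v u) {K : Finset α}
    (h : Linked R K) :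
    ∀ n, ∀ B ⊆ K, B.Nonempty → (K \ B).card = n →
      ∑ v ∈ B, (nbrs R B v).card + 2 * K.card ≤ ∑ v ∈ K, (nbrs R K v).card + 2 * B.card := by
  intro n
  induction n with
  | zero =>
    intro B hB _ hc
    rw [Finset.card_eq_zero, Finset.sdiff_eq_empty_iff_subset] at hc
    rw [Finset.Subset.antisymm hB hc]
  | succ n ih =>
    intro B hB hne hc
    have hBK : B ≠ K := by
      rintro rfl
      simp at hc
    obtain ⟨u, hu, v, hv, hvB, huv⟩ := h B hB hne hBK
    have h1 := ih (insert v B) (Finset.insert_subset hv hB) (Finset.insert_nonempty _ _) (by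
      rw [Finset.sdiff_insert, Finset.card_erase_of_mem (Finset.mem_sdiff.2 ⟨hv, hvB⟩), hc]
      rfl)
    rw [Finset.card_insert_of_notMem hvB, Finset.sum_insert hvB] at h1
    have h2 : 0 < (nbrs R (insert v B) v).card :=
      Finset.card_pos.2 ⟨u, mem_nbrs.2 ⟨Finset.mem_insert_of_mem hu, hR _ _ huv⟩⟩
    have h3 : ∑ x ∈ B, (nbrs R B x).card < ∑ x ∈ B, (nbrs R (insert v B) x).card := by
      refine Finset.sum_lt_sum (fun x _ => Finset.card_le_card
        (nbrs_mono (Finset.subset_insert _ _) fun _ _ h => h)) ⟨u, hu, Finset.card_lt_card ?_⟩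
      rw [Finset.ssubset_iff_of_subset (nbrs_mono (Finset.subset_insert _ _) fun _ _ h => h)]
      exact ⟨v, mem_nbrs.2 ⟨Finset.mem_insert_self _ _, huv⟩, fun hh => hvB (mem_nbrs.1 hh).1⟩
    omega

end Counting

variable {V : Type*} [Fintype V]

/-- The degree of a vertex. -/
noncomputable def deg (G : SimpleGraph V) (v : V) : ℕ := (nbrs G.Adj Finset.univ v).card

/-- The vertices of degree at least three. -/
noncomputable def bigVertices (G : SimpleGraph V) : Finset V :=
  Finset.univ.filter fun v => 3 ≤ deg G v

/-- The vertices of degree two. -/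
noncomputable def smallVertices (G : SimpleGraph V) : Finset V :=
  Finset.univ.filter fun v => deg G v = 2

variable {G : SimpleGraph V}

theorem mem_bigVertices {v : V} : v ∈ bigVertices G ↔ 3 ≤ deg G v := by simp [bigVertices]

theorem mem_smallVertices {v : V} : v ∈ smallVertices G ↔ deg G v = 2 := by simp [smallVertices]

theorem disjoint_big_small : Disjoint (bigVertices G) (smallVertices G) := by
  rw [Finset.disjoint_left]
  intro v h1 h2
  rw [mem_bigVertices] at h1
  rw [mem_smallVertices] at h2
  omega

variable [DecidableEq V]

/-- Give each vertex the charge `8 - 3 * deg`, of positive total. A vertex of degree two has charge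
2 and sends 1 to each of its two neighbours, both of degree at least three. This leaves precisely
the stated weights. -/
theorem weight_pos (hdeg : ∀ v, 2 ≤ deg G v)
    (hind : ∀ u v, deg G u = 2 → deg G v = 2 → ¬ G.Adj u v)
    (hlt : 3 * ∑ v, deg G v < 8 * Fintype.card V) :
    0 < ∑ v ∈ bigVertices G,
      (8 - 2 * (deg G v : ℤ) - ((nbrs G.Adj (bigVertices G) v).card : ℤ)) := by
  have hunion : (Finset.univ : Finset V) = bigVertices G ∪ smallVertices G := by
    ext v
    have := hdeg v
    simp only [Finset.mem_univ, Finset.mem_union, mem_bigVertices, mem_smallVertices, true_iff]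
    omega
  have hsum : ∀ f : V → ℤ, ∑ v, f v = ∑ v ∈ bigVertices G, f v + ∑ v ∈ smallVertices G, f v := by
    intro f
    rw [hunion, Finset.sum_union disjoint_big_small]
  have hd : ∀ v, (nbrs G.Adj (bigVertices G) v).card + (nbrs G.Adj (smallVertices G) v).card
      = deg G v := by
    intro v
    rw [deg, ← Finset.card_union_of_disjoint]
    · congr 1
      ext x
      have : x ∈ bigVertices G ∪ smallVertices G := hunion ▸ Finset.mem_univ x
      rw [Finset.mem_union] at this
      simp only [Finset.mem_union, mem_nbrs, Finset.mem_univ, true_and]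
      tauto
    · have := disjoint_big_small (G := G)
      rw [Finset.disjoint_left] at this ⊢
      exact fun x hx hx' => this (mem_nbrs.1 hx).1 (mem_nbrs.1 hx').1
  have hsmall : ∀ m ∈ smallVertices G, (nbrs G.Adj (bigVertices G) m).card = 2 := by
    intro m hm
    rw [mem_smallVertices] at hm
    have h0 : nbrs G.Adj (smallVertices G) m = ∅ := by
      rw [Finset.eq_empty_iff_forall_notMem]
      intro x hx
      rw [mem_nbrs, mem_smallVertices] at hx
      exact hind m x hm hx.1 hx.2
    have := hd m
    rw [h0, Finset.card_empty] at this
    omega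
  have hcomm := sum_card_nbrs_comm (R := G.Adj) (fun _ _ h => h.symm)
    (bigVertices G) (smallVertices G)
  rw [Finset.sum_congr rfl hsmall, Finset.sum_const, smul_eq_mul] at hcomm
  have h1 : ∑ v ∈ bigVertices G, ((nbrs G.Adj (smallVertices G) v).card : ℤ)
      = (smallVertices G).card * 2 := by exact_mod_cast hcomm
  have h2 := hsum fun v => 3 * (deg G v : ℤ) - 8
  have h3 : ∑ v, (3 * (deg G v : ℤ) - 8) < 0 := by
    rw [Finset.sum_sub_distrib, ← Finset.mul_sum]
    simp only [Finset.sum_const, Finset.card_univ, nsmul_eq_mul]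
    have : (3 * ∑ v, (deg G v : ℤ)) < 8 * (Fintype.card V : ℤ) := by exact_mod_cast hlt
    linarith
  have h4 : ∑ v ∈ smallVertices G, (3 * (deg G v : ℤ) - 8) = (smallVertices G).card * (-2) := by
    rw [Finset.sum_congr rfl (g := fun _ => (-2 : ℤ)), Finset.sum_const, nsmul_eq_mul]
    intro v hv
    rw [mem_smallVertices] at hv
    rw [hv]; norm_num
  have h5 : ∑ v ∈ bigVertices G,
      (8 - 2 * (deg G v : ℤ) - ((nbrs G.Adj (bigVertices G) v).card : ℤ)) =
      ∑ v ∈ bigVertices G, ((nbrs G.Adj (smallVertices G) v).card : ℤ)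
        - ∑ v ∈ bigVertices G, (3 * (deg G v : ℤ) - 8) := by
    rw [← Finset.sum_sub_distrib]
    refine Finset.sum_congr rfl fun v _ => ?_
    have : ((nbrs G.Adj (bigVertices G) v).card : ℤ) + (nbrs G.Adj (smallVertices G) v).card
      = deg G v := by exact_mod_cast hd v
    linarith
  rw [h5]
  linarith

/-- A sparse graph has a component of its vertices of degree at least three that is a tree of
vertices of degree three. -/
theorem exists_tree_component (hdeg : ∀ v, 2 ≤ deg G v)
    (hind : ∀ u v, deg G u = 2 → deg G v = 2 → ¬ G.Adj u v)
    (hlt : 3 * ∑ v, deg G v < 8 * Fintype.card V) :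
    ∃ K ⊆ bigVertices G, K.Nonempty ∧ (∀ u ∈ K, ∀ v ∈ bigVertices G, G.Adj u v → v ∈ K) ∧
      Linked G.Adj K ∧ Degenerate G.Adj K ∧ ∀ v ∈ K, deg G v = 3 := by
  set ω : V → ℤ := fun v =>
    8 - 2 * (deg G v : ℤ) - ((nbrs G.Adj (bigVertices G) v).card : ℤ) with hω
  have hpos : 0 < ∑ v ∈ bigVertices G, ω v := weight_pos hdeg hind hlt
  classical
  obtain ⟨K, hK, hmin⟩ := Finset.exists_min_image
    ((bigVertices G).powerset.filter fun K =>
      (∀ u ∈ K, ∀ v ∈ bigVertices G, G.Adj u v → v ∈ K) ∧ 0 < ∑ v ∈ K, ω v) Finset.card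
    ⟨bigVertices G, by
      rw [Finset.mem_filter, Finset.mem_powerset]
      exact ⟨subset_rfl, fun _ _ v hv _ => hv, hpos⟩⟩
  rw [Finset.mem_filter, Finset.mem_powerset] at hK
  obtain ⟨hKbig, hclosed, hKpos⟩ := hK
  have hsmaller : ∀ B ⊆ K, B ≠ K → (∀ u ∈ B, ∀ v ∈ bigVertices G, G.Adj u v → v ∈ B) →
      ∑ v ∈ B, ω v ≤ 0 := by
    intro B hB hBK hBcl
    by_contra! hcon
    have := hmin B (by
      rw [Finset.mem_filter, Finset.mem_powerset]
      exact ⟨hB.trans hKbig, hBcl, hcon⟩)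
    exact absurd (Finset.card_lt_card (hB.ssubset_of_ne hBK)) (by omega)
  have hne : K.Nonempty := by
    rw [Finset.nonempty_iff_ne_empty]
    rintro rfl
    simp at hKpos
  -- If `K` split into two closed pieces, one of them would have positive weight, against
  -- minimality.
  have hlinked : Linked G.Adj K := by
    intro B hB hBne hBK
    by_contra! hcon
    have h1 := hsmaller B hB hBK fun u hu v hv huv => by
      by_contra hvB
      exact hcon u hu v (hclosed u (hB hu) v hv huv) hvB huv
    have h2 := hsmaller (K \ B) Finset.sdiff_subset (by
        obtain ⟨b, hb⟩ := hBne
        intro heq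
        have := heq ▸ hB hb
        exact (Finset.mem_sdiff.1 this).2 hb) fun u hu v hv huv => by
      rw [Finset.mem_sdiff] at hu ⊢
      refine ⟨hclosed u hu.1 v hv huv, fun hvB => ?_⟩
      exact hcon v hvB u hu.1 hu.2 huv.symm
    have h3 := Finset.sum_sdiff (f := ω) hB
    linarith
  have hdK : ∀ v ∈ K, nbrs G.Adj (bigVertices G) v = nbrs G.Adj K v := by
    intro v hv
    ext x
    rw [mem_nbrs, mem_nbrs]
    exact ⟨fun hx => ⟨hclosed v hv x hx.1 hx.2, hx.2⟩, fun hx => ⟨hKbig hx.1, hx.2⟩⟩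
  have hωK : ∑ v ∈ K, ω v =
      ∑ v ∈ K, (8 - 2 * (deg G v : ℤ)) - ((∑ v ∈ K, (nbrs G.Adj K v).card : ℕ) : ℤ) := by
    rw [Nat.cast_sum, ← Finset.sum_sub_distrib]
    exact Finset.sum_congr rfl fun v hv => by rw [hω]; simp only [hdK v hv]
  have hle : ∀ v ∈ K, 8 - 2 * (deg G v : ℤ) ≤ 2 := by
    intro v hv
    have := mem_bigVertices.1 (hKbig hv)
    omega
  have hsumle := Finset.sum_le_sum hle
  rw [Finset.sum_const, nsmul_eq_mul] at hsumle
  have hgrow : ∀ B ⊆ K, B.Nonempty → ∑ v ∈ B, (nbrs G.Adj B v).card + 2 * K.card ≤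
      ∑ v ∈ K, (nbrs G.Adj K v).card + 2 * B.card := fun B hB hBne =>
    hlinked.sum_card_nbrs_le (fun _ _ h => h.symm) _ B hB hBne rfl
  -- The weight of `K` is at most twice its vertices minus twice its edges, less 2 for each unit of
  -- degree above three. A subset of minimum degree two would give as many edges as vertices, and a
  -- vertex of degree four would cancel the 2 available in a tree.
  refine ⟨K, hKbig, hne, hclosed, hlinked, fun B hB hBne => ?_, fun v hv => ?_⟩
  · by_contra! hcon
    have h1 := Finset.sum_le_sum (s := B) (f := fun _ => 2) (g := fun v => (nbrs G.Adj B v).card)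
      fun v hv => hcon v hv
    rw [Finset.sum_const, smul_eq_mul] at h1
    have h2 := hgrow B hB hBne
    omega
  · have h1 := hgrow {v} (by simpa using hv) (Finset.singleton_nonempty v)
    rw [Finset.card_singleton] at h1
    have h2 := mem_bigVertices.1 (hKbig hv)
    by_contra hne3
    have h6 := Finset.add_sum_erase K (fun u => 8 - 2 * (deg G u : ℤ)) hv
    have h3 := Finset.sum_le_sum fun u hu => hle u (Finset.mem_of_mem_erase (a := v) hu)
    rw [Finset.sum_const, nsmul_eq_mul, Finset.card_erase_of_mem hv] at h3
    have h4 := hne.card_pos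
    push_cast [Nat.cast_sub (show 1 ≤ K.card from h4)] at h3
    omega

end SignedColoring

/-! ### Critical signed graphs and their tree systems -/

namespace SignedColoring

variable {V : Type*}

/-- The part of the signed graph on the vertex set `A` can be coloured. -/
def ColorableOn (G : SimpleGraph V) (σ : V → V → ZMod 2) (A : Set V) : Prop :=
  ∃ φ : V → Color, ∀ u ∈ A, ∀ v ∈ A, G.Adj u v → Compatible (σ u v) (φ u) (φ v)

/-- The signed graph cannot be coloured, but all its proper induced subgraphs can. -/
structure IsCritical (G : SimpleGraph V) (σ : V → V → ZMod 2) : Prop where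
  not_colorable : ¬ ColorableOn G σ Set.univ
  colorable : ∀ A : Set V, A ≠ Set.univ → ColorableOn G σ A

variable {G : SimpleGraph V} {σ : V → V → ZMod 2}

theorem exists_compatible (τ : ZMod 2) (c : Color) : ∃ d, Compatible τ d c := by
  revert τ c
  decide

/-- The colours compatible with `c` have both first coordinates, so `d` can be chosen with first
coordinate other than `c'.1`. Then `d` and `c'` do not clash. -/
theorem exists_compatible_path (τ₁ τ₂ τ₃ : ZMod 2) (c c' : Color) :
    ∃ d d', Compatible τ₁ d c ∧ Compatible τ₂ d d' ∧ Compatible τ₃ d' c' := by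
  revert τ₁ τ₂ τ₃ c c'
  decide

variable [Fintype V]

theorem adj_of_deg_eq_two {m x y : V} (hm : deg G m = 2) (hx : G.Adj m x) (hy : G.Adj m y)
    (hxy : x ≠ y) {z : V} (hz : G.Adj m z) : z = x ∨ z = y := by
  by_contra! hcon
  have h3 : 2 < (nbrs G.Adj Finset.univ m).card :=
    Finset.two_lt_card.2 ⟨x, by simp [mem_nbrs, hx], y, by simp [mem_nbrs, hy], z,
      by simp [mem_nbrs, hz], hxy, hcon.1.symm, hcon.2.symm⟩
  unfold deg at hm
  omega

theorem exists_other_nbr {m x : V} (hm : deg G m = 2) : ∃ y, G.Adj m y ∧ y ≠ x := by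
  have h1 : 1 < (nbrs G.Adj Finset.univ m).card := by unfold deg at hm; omega
  obtain ⟨y, hy, hyx⟩ := Finset.exists_mem_ne h1 x
  exact ⟨y, (mem_nbrs.1 hy).2, hyx⟩

/-- The vertices of degree two joining `u` and `v`. -/
noncomputable def midpoints (G : SimpleGraph V) (u v : V) : Finset V :=
  nbrs G.Adj (nbrs G.Adj (smallVertices G) u) v

theorem mem_midpoints {u v m : V} :
    m ∈ midpoints G u v ↔ deg G m = 2 ∧ G.Adj u m ∧ G.Adj v m := by
  rw [midpoints, mem_nbrs, mem_nbrs, mem_smallVertices, and_assoc]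

variable [DecidableEq V]

theorem IsCritical.two_le_deg (hσ : ∀ u v, σ u v = σ v u) (h : IsCritical G σ) (v : V) :
    2 ≤ deg G v := by
  by_contra! hlt
  obtain ⟨φ, hφ⟩ := h.colorable {v}ᶜ (by
    intro heq
    have : v ∈ ({v}ᶜ : Set V) := heq ▸ Set.mem_univ v
    simp at this)
  have hex : ∃ d, ∀ u, G.Adj v u → Compatible (σ v u) d (φ u) := by
    rcases (nbrs G.Adj Finset.univ v).eq_empty_or_nonempty with h0 | ⟨w, hw⟩
    · refine ⟨(0, 0), fun u hu => ?_⟩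
      have : u ∈ nbrs G.Adj Finset.univ v := mem_nbrs.2 ⟨Finset.mem_univ u, hu⟩
      simp [h0] at this
    · obtain ⟨d, hd⟩ := exists_compatible (σ v w) (φ w)
      refine ⟨d, fun u hu => ?_⟩
      have hc : (nbrs G.Adj Finset.univ v).card ≤ 1 := by unfold deg at hlt; omega
      rwa [Finset.card_le_one.1 hc u (mem_nbrs.2 ⟨Finset.mem_univ u, hu⟩) w hw]
  obtain ⟨d, hd⟩ := hex
  refine h.not_colorable ⟨Function.update φ v d, fun a _ b _ hab => ?_⟩
  by_cases hav : a = v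
  · subst hav
    simpa [hab.ne'] using hd b hab
  · by_cases hbv : b = v
    · subst hbv
      rw [hσ]
      simpa [hav] using (hd a hab.symm).symm
    · simpa [hav, hbv] using hφ a hav b hbv hab

theorem IsCritical.not_adj_of_deg_eq_two (hσ : ∀ u v, σ u v = σ v u) (h : IsCritical G σ)
    (a b : V) (ha : deg G a = 2) (hb : deg G b = 2) : ¬ G.Adj a b := by
  intro hab
  obtain ⟨x, hax, hxb⟩ := exists_other_nbr (x := b) ha
  obtain ⟨y, hby, hya⟩ := exists_other_nbr (x := a) hb
  obtain ⟨φ, hφ⟩ := h.colorable {v | v ≠ a ∧ v ≠ b} (by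
    intro heq
    have : a ∈ {v | v ≠ a ∧ v ≠ b} := heq ▸ Set.mem_univ a
    simp at this)
  obtain ⟨d, d', h1, h2, h3⟩ := exists_compatible_path (σ a x) (σ a b) (σ b y) (φ x) (φ y)
  let ψ : V → Color := fun v => if v = a then d else if v = b then d' else φ v
  have ψa : ψ a = d := by simp [ψ]
  have ψb : ψ b = d' := by simp [ψ, hab.ne']
  have ψo : ∀ v, v ≠ a → v ≠ b → ψ v = φ v := fun v hva hvb => by simp [ψ, hva, hvb]
  have ea : ∀ u, G.Adj a u → Compatible (σ a u) (ψ a) (ψ u) := by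
    intro u hu
    rcases adj_of_deg_eq_two ha hax hab hxb hu with rfl | rfl
    · rwa [ψa, ψo u hax.ne' hxb]
    · rwa [ψa, ψb]
  have eb : ∀ u, G.Adj b u → Compatible (σ b u) (ψ b) (ψ u) := by
    intro u hu
    rcases adj_of_deg_eq_two hb hby hab.symm hya hu with rfl | rfl
    · rwa [ψb, ψo u hya hby.ne']
    · rw [ψa, ψb, hσ]
      exact h2.symm
  refine h.not_colorable ⟨ψ, fun u _ v _ huv => ?_⟩
  by_cases hua : u = a
  · exact hua ▸ ea v (hua ▸ huv)
  by_cases hub : u = b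
  · exact hub ▸ eb v (hub ▸ huv)
  by_cases hva : v = a
  · rw [hσ]
    exact hva ▸ (ea u (hva ▸ huv.symm)).symm
  by_cases hvb : v = b
  · rw [hσ]
    exact hvb ▸ (eb u (hvb ▸ huv.symm)).symm
  rw [ψo u hua hub, ψo v hva hvb]
  exact hφ u ⟨hua, hub⟩ v ⟨hva, hvb⟩ huv

/-- Each degree-two neighbour of `u` has exactly one other neighbour `v`. -/
theorem sum_card_midpoints (u : V) :
    ∑ v ∈ Finset.univ.erase u, (midpoints G u v).card = (nbrs G.Adj (smallVertices G) u).card := by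
  unfold midpoints
  rw [sum_card_nbrs_comm (fun _ _ h => h.symm), Finset.card_eq_sum_ones]
  refine Finset.sum_congr rfl fun m hm => ?_
  rw [mem_nbrs, mem_smallVertices] at hm
  have h1 : nbrs G.Adj (Finset.univ.erase u) m = (nbrs G.Adj Finset.univ m).erase u := by
    ext x
    simp [mem_nbrs, and_comm]
  rw [h1, Finset.card_erase_of_mem (mem_nbrs.2 ⟨Finset.mem_univ u, hm.2.symm⟩)]
  have := hm.1
  unfold deg at this
  omega

/-- The clash constraints caused by the vertices of degree two. -/
noncomputable def clashes (G : SimpleGraph V) (σ : V → V → ZMod 2) (u v : V) : Finset (ZMod 2) :=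
  if u = v then ∅ else (midpoints G u v).image fun m => σ m u + σ m v + 1

/-- The colours forbidden by paths of length two to coloured vertices outside `K`. -/
noncomputable def forbidden (G : SimpleGraph V) (σ : V → V → ZMod 2) (φ : V → Color)
    (K : Finset V) (v : V) : Finset Color :=
  (Finset.univ \ K).biUnion fun y =>
    (midpoints G v y).image fun m => ((φ y).1, (φ y).2 + (σ m v + σ m y + 1))

/-- Each of the three edges at `v` accounts for at most one constraint: it stays in `K`, or enters a
degree-two vertex whose other end gives a clash (inside `K`) or a forbidden colour (outside). -/
theorem isTreeSystem_of_component (σ : V → V → ZMod 2) (φ : V → Color) {K : Finset V}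
    (hK : K ⊆ bigVertices G)
    (hne : K.Nonempty) (hlinked : Linked G.Adj K) (hdegen : Degenerate G.Adj K)
    (hdeg : ∀ v ∈ K, deg G v = 3) :
    IsTreeSystem G K (forbidden G σ φ K) (clashes G σ) := by
  refine ⟨hne, hlinked, hdegen, fun u v => ?_, fun v => by simp [clashes], fun v hv => ?_⟩
  · unfold clashes
    by_cases huv : u = v
    · simp [huv]
    · rw [if_neg huv, if_neg (Ne.symm huv)]
      ext t
      simp only [Finset.mem_image, mem_midpoints]
      constructor <;> rintro ⟨m, ⟨h1, h2, h3⟩, h4⟩ <;>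
        exact ⟨m, ⟨h1, h3, h2⟩, by rw [← h4]; ring⟩
  · have h1 : (forbidden G σ φ K v).card ≤ ∑ y ∈ Finset.univ \ K, (midpoints G v y).card :=
      Finset.card_biUnion_le.trans (Finset.sum_le_sum fun _ _ => Finset.card_image_le)
    have h2 : ∑ u ∈ K, (clashes G σ v u).card ≤ ∑ u ∈ K.erase v, (midpoints G v u).card := by
      rw [← Finset.add_sum_erase K _ hv]
      simp only [clashes, if_true, Finset.card_empty, zero_add]
      refine Finset.sum_le_sum fun u hu => ?_
      rw [if_neg (Finset.ne_of_mem_erase hu).symm]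
      exact Finset.card_image_le
    have h3 : ∑ u ∈ K.erase v, (midpoints G v u).card +
        ∑ y ∈ Finset.univ \ K, (midpoints G v y).card =
        ∑ y ∈ Finset.univ.erase v, (midpoints G v y).card := by
      rw [← Finset.sum_union]
      · congr 1
        ext x
        simp only [Finset.mem_union, Finset.mem_erase, Finset.mem_sdiff, Finset.mem_univ, true_and,
          and_true]
        constructor
        · rintro (hx | hx)
          · exact hx.1
          · exact fun hxv => hx (hxv ▸ hv)
        · intro hx
          by_cases hxK : x ∈ K
          · exact Or.inl ⟨hx, hxK⟩
          · exact Or.inr hxK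
      · rw [Finset.disjoint_left]
        exact fun x hx hx' => (Finset.mem_sdiff.1 hx').2 (Finset.mem_of_mem_erase hx)
    rw [sum_card_midpoints] at h3
    have h4 := card_nbrs_add_card_nbrs (R := G.Adj) (Finset.subset_univ K)
      (Finset.subset_univ (smallVertices G)) (disjoint_big_small.mono_left hK) v
    have h5 := hdeg v hv
    unfold deg at h5
    omega

/-- A solution of the system on a component of the vertices of degree at least three extends a
colouring of the rest of the graph. -/
theorem colorableOn_univ_of_solvable (hσ : ∀ u v, σ u v = σ v u) (hdeg : ∀ v, 2 ≤ deg G v)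
    (hind : ∀ u v, deg G u = 2 → deg G v = 2 → ¬ G.Adj u v) {K : Finset V}
    (hK : K ⊆ bigVertices G) (hclosed : ∀ u ∈ K, ∀ v ∈ bigVertices G, G.Adj u v → v ∈ K)
    {φ₀ : V → Color}
    (hφ₀ : ∀ u v, u ∉ K → v ∉ K → (deg G u = 2 → ∀ x ∈ K, ¬ G.Adj x u) →
      (deg G v = 2 → ∀ x ∈ K, ¬ G.Adj x v) → G.Adj u v → Compatible (σ u v) (φ₀ u) (φ₀ v))
    (hsol : Solvable G σ K (forbidden G σ φ₀ K) (clashes G σ)) : ColorableOn G σ Set.univ := by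
  obtain ⟨φ, h1, h2, h3⟩ := hsol
  have hbig : ∀ v, deg G v ≠ 2 → v ∈ bigVertices G := fun v hv => by
    have := hdeg v
    rw [mem_bigVertices]
    omega
  let ψ : V → Color := fun v => if v ∈ K then φ v else φ₀ v
  have ψK : ∀ v ∈ K, ψ v = φ v := fun v hv => by simp [ψ, hv]
  have ψo : ∀ v ∉ K, ψ v = φ₀ v := fun v hv => by simp [ψ, hv]
  have hmid : ∀ m, deg G m = 2 → ∃ d, ∀ y, G.Adj m y → Compatible (σ m y) d (ψ y) := by
    intro m hm
    by_cases hx : ∃ x ∈ K, G.Adj x m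
    · obtain ⟨x, hxK, hxm⟩ := hx
      obtain ⟨y, hmy, hyx⟩ := exists_other_nbr (x := x) hm
      -- The system on `K` was built to ensure this: by a clash constraint if `y` lies in `K`, by a
      -- forbidden colour at `x` otherwise.
      have hnc : ¬ Clash (σ m x + σ m y + 1) (ψ x) (ψ y) := by
        have hmem : m ∈ midpoints G x y := mem_midpoints.2 ⟨hm, hxm, hmy.symm⟩
        by_cases hyK : y ∈ K
        · rw [ψK x hxK, ψK y hyK]
          refine h3 x hxK y hyK _ ?_
          unfold clashes
          rw [if_neg hyx.symm]
          exact Finset.mem_image_of_mem (fun m => σ m x + σ m y + 1) hmem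
        · rw [ψK x hxK, ψo y hyK]
          intro hc
          refine h1 x hxK ?_
          unfold forbidden
          refine Finset.mem_biUnion.2 ⟨y, by simp [hyK], Finset.mem_image.2 ⟨m, hmem, ?_⟩⟩
          refine Prod.ext hc.1.symm ?_
          simp only
          rw [← hc.2, add_comm (φ x).2, ← add_assoc, zmod_two_add_self, zero_add]
      obtain ⟨d, hd1, hd2⟩ := exists_compatible_of_not_clash hnc
      refine ⟨d, fun z hz => ?_⟩
      rcases adj_of_deg_eq_two hm hxm.symm hmy hyx.symm hz with rfl | rfl
      exacts [hd1, hd2]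
    · push Not at hx
      refine ⟨φ₀ m, fun y hmy => ?_⟩
      have hyK : y ∉ K := fun hyK => hx y hyK hmy.symm
      have hmK : m ∉ K := fun hmK => by
        have := mem_bigVertices.1 (hK hmK)
        omega
      rw [ψo y hyK]
      exact hφ₀ m y hmK hyK (fun _ => hx) (fun hy => absurd hmy (hind m y hm hy)) hmy
  choose! d hd using hmid
  let χ : V → Color := fun v => if deg G v = 2 then d v else ψ v
  have χm : ∀ v, deg G v = 2 → χ v = d v := fun v hv => by simp [χ, hv]
  have χo : ∀ v, deg G v ≠ 2 → χ v = ψ v := fun v hv => by simp [χ, hv]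
  refine ⟨χ, fun u _ v _ huv => ?_⟩
  by_cases hu : deg G u = 2
  · have hv : deg G v ≠ 2 := fun hv => hind u v hu hv huv
    rw [χm u hu, χo v hv]
    exact hd u hu v huv
  by_cases hv : deg G v = 2
  · rw [χm v hv, χo u hu, hσ]
    exact (hd v hv u huv.symm).symm
  rw [χo u hu, χo v hv]
  by_cases huK : u ∈ K
  · have hvK := hclosed u huK v (hbig v hv) huv
    rw [ψK u huK, ψK v hvK]
    exact h2 u huK v hvK huv
  · have hvK : v ∉ K := fun hvK => huK (hclosed v hvK u (hbig u hu) huv.symm)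
    rw [ψo u huK, ψo v hvK]
    exact hφ₀ u v huK hvK (fun h => absurd h hu) (fun h => absurd h hv) huv

/-- The configuration of the exceptional graph: a vertex `w` with the neighbours `u₁, u₂, u₃`,
joined in pairs by the vertices `m₁₂, m₁₃, m₂₃` of degree two. -/
structure IsConfig (G : SimpleGraph V) (σ : V → V → ZMod 2) (w u₁ u₂ u₃ m₁₂ m₁₃ m₂₃ : V) :
    Prop where
  ne12 : u₁ ≠ u₂
  ne13 : u₁ ≠ u₃
  ne23 : u₂ ≠ u₃
  degw : deg G w = 3
  adj1 : G.Adj w u₁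
  adj2 : G.Adj w u₂
  adj3 : G.Adj w u₃
  mem12 : m₁₂ ∈ midpoints G u₁ u₂
  mem13 : m₁₃ ∈ midpoints G u₁ u₃
  mem23 : m₂₃ ∈ midpoints G u₂ u₃
  sign12 : σ m₁₂ u₁ + σ m₁₂ u₂ + 1 = σ w u₁ + σ w u₂
  sign13 : σ m₁₃ u₁ + σ m₁₃ u₃ + 1 = σ w u₁ + σ w u₃
  sign23 : σ m₂₃ u₂ + σ m₂₃ u₃ + 1 = σ w u₂ + σ w u₃

/-- A critical signed graph has at least `4n/3` edges, or contains the exceptional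
configuration. -/
theorem IsCritical.le_sum_deg_or_isConfig (hσ : ∀ u v, σ u v = σ v u) (h : IsCritical G σ) :
    8 * Fintype.card V ≤ 3 * ∑ v, deg G v ∨
      ∃ w u₁ u₂ u₃ m₁₂ m₁₃ m₂₃, IsConfig G σ w u₁ u₂ u₃ m₁₂ m₁₃ m₂₃ := by
  refine or_iff_not_imp_left.2 fun hlt => ?_
  push Not at hlt
  have hdeg := h.two_le_deg hσ
  have hind := h.not_adj_of_deg_eq_two hσ
  obtain ⟨K, hK, hne, hclosed, hlinked, hdegen, hdeg3⟩ := exists_tree_component hdeg hind hlt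
  -- Besides `K`, the degree-two vertices attached to it are uncoloured; they are coloured last.
  obtain ⟨φ₀, hφ₀⟩ := h.colorable {v | v ∉ K ∧ (deg G v = 2 → ∀ x ∈ K, ¬ G.Adj x v)} (by
    obtain ⟨x, hx⟩ := hne
    intro heq
    have : x ∈ {v | v ∉ K ∧ (deg G v = 2 → ∀ x ∈ K, ¬ G.Adj x v)} := heq ▸ Set.mem_univ x
    exact this.1 hx)
  rcases (isTreeSystem_of_component σ φ₀ hK hne hlinked hdegen hdeg3).solvable_or_exceptional hσ
    with hsol | hex
  · exact absurd (colorableOn_univ_of_solvable hσ hdeg hind hK hclosed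
      (fun u v hu hv hu' hv' => hφ₀ u ⟨hu, hu'⟩ v ⟨hv, hv'⟩) hsol) h.not_colorable
  · obtain ⟨w, u₁, u₂, u₃, h12, h13, h23, rfl, hw1, hw2, hw3, d12, d13, d23⟩ := hex
    have extract : ∀ u v t, u ≠ v → clashes G σ u v = {t} →
        ∃ m ∈ midpoints G u v, σ m u + σ m v + 1 = t := by
      intro u v t huv hc
      rw [clashes, if_neg huv] at hc
      have : t ∈ (midpoints G u v).image fun m => σ m u + σ m v + 1 := by simp [hc]
      exact Finset.mem_image.1 this
    obtain ⟨m₁₂, e12, s12⟩ := extract _ _ _ h12 d12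
    obtain ⟨m₁₃, e13, s13⟩ := extract _ _ _ h13 d13
    obtain ⟨m₂₃, e23, s23⟩ := extract _ _ _ h23 d23
    exact ⟨w, u₁, u₂, u₃, m₁₂, m₁₃, m₂₃, h12, h13, h23, hdeg3 _ (by simp), hw1, hw2, hw3, e12, e13, e23, s12, s13, s23⟩

end SignedColoring

/-! ### From oriented graphs to signed graphs -/

namespace SignedColoring

open OrientedGraph

/-- The part of the 4-cycle that contains a vertex. -/
def part : Fin 4 → ZMod 2 := ![0, 1, 0, 1]

/-- The position of a vertex of the 4-cycle in its part. -/
def pos : Fin 4 → ZMod 2 := ![0, 0, 1, 1]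

/-- The vertex of the 4-cycle with given part and position. -/
def corner (c x : ZMod 2) : Fin 4 := 
  if c = 0 then (if x = 0 then 0 else 2) else if x = 0 then 1 else 3

theorem part_corner (c x : ZMod 2) : part (corner c x) = c := by
  revert c x
  decide

theorem pos_corner (c x : ZMod 2) : pos (corner c x) = x := by
  revert c x
  decide

/-- Pushing preserves the parity of the number of forward arcs. The first hypothesis excludes two
forward arcs; the second excludes zero and four, which pushing vertex `0` would turn into two. So
the number is odd, and `γ` switches the signs to `pos i * pos j`. -/
theorem exists_switching_of_orientation (e : Fin 4 → Bool)
    (h₀ : (Finset.univ.filter fun i => e i = true).card ≠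
      (Finset.univ.filter fun i => e i = false).card)
    (h₁ : (Finset.univ.filter fun i : Fin 4 => e i = decide ((i = 0) ↔ (i + 1 = 0))).card ≠
      (Finset.univ.filter fun i : Fin 4 => e i = !decide ((i = 0) ↔ (i + 1 = 0))).card) :
    ∃ γ : Fin 4 → ZMod 2, ∀ i j, ((j = i + 1 ∧ e i = true) ∨ (i = j + 1 ∧ e j = false)) ↔
      part i ≠ part j ∧ γ i + γ j + pos i * pos j = part i := by
  revert e
  decide

/-- An unbalanced 4-cycle in coordinates. -/
theorem exists_switching {C : OrientedGraph (Fin 4)} (hC : C.IsUnbalancedFourCycle) :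
    ∃ γ : Fin 4 → ZMod 2, ∀ i j, C.Arc i j ↔
      part i ≠ part j ∧ γ i + γ j + pos i * pos j = part i := by
  classical
  obtain ⟨hund, hbal⟩ := hC
  let e : Fin 4 → Bool := fun i => decide (C.Arc i (i + 1))
  have hadj : ∀ i j, (C.Arc i j ∨ C.Arc j i) ↔ (j = i + 1 ∨ i = j + 1) := by
    intro i j
    have h1 : C.underlying.Adj i j ↔ (SimpleGraph.cycleGraph 4).Adj i j := by rw [hund]
    have h2 : ∀ i j : Fin 4, (SimpleGraph.cycleGraph 4).Adj i j ↔ (j = i + 1 ∨ i = j + 1) := by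
      decide
    exact h1.trans (h2 i j)
  have hback : ∀ i, C.Arc (i + 1) i ↔ ¬ C.Arc i (i + 1) := fun i =>
    ⟨fun h => C.asymm _ _ h, fun h => ((hadj i (i + 1)).2 (Or.inl rfl)).resolve_left h⟩
  have harc : ∀ i j, C.Arc i j ↔ (j = i + 1 ∧ e i = true) ∨ (i = j + 1 ∧ e j = false) := by
    intro i j
    simp only [e, decide_eq_true_eq, decide_eq_false_iff_not]
    constructor
    · intro h
      rcases (hadj i j).1 (Or.inl h) with rfl | rfl
      · exact Or.inl ⟨rfl, h⟩
      · exact Or.inr ⟨rfl, (hback j).1 h⟩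
    · rintro (⟨rfl, h⟩ | ⟨rfl, h⟩)
      · exact h
      · exact (hback j).2 h
  have hcount : ∀ b : Fin 4 → Prop, ∀ _ : DecidablePred b,
      (Finset.univ.filter fun i : Fin 4 => e i = decide (b i ↔ b (i + 1))).card ≠
      (Finset.univ.filter fun i : Fin 4 => e i = !decide (b i ↔ b (i + 1))).card := by
    intro b _
    have h := hbal {i | b i}
    have h1 : {i : Fin 4 | (C.push {i | b i}).Arc i (i + 1)} =
        ((Finset.univ.filter fun i : Fin 4 => e i = decide (b i ↔ b (i + 1)) : Finset (Fin 4)) :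
          Set (Fin 4)) := by
      ext i
      simp only [push, e, hback, Set.mem_ofPred_eq, Finset.coe_filter, Finset.mem_univ, true_and]
      by_cases h2 : b i ↔ b (i + 1) <;> simp [h2]
    have h2 : {i : Fin 4 | (C.push {i | b i}).Arc (i + 1) i} =
        ((Finset.univ.filter fun i : Fin 4 => e i = !decide (b i ↔ b (i + 1)) : Finset (Fin 4)) :
          Set (Fin 4)) := by
      ext i
      simp only [push, e, hback, Set.mem_ofPred_eq, Finset.coe_filter, Finset.mem_univ, true_and]
      rw [iff_comm (a := b (i + 1))]
      by_cases h2 : b i ↔ b (i + 1) <;> simp [h2]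
    rwa [h1, h2, Set.ncard_coe_finset, Set.ncard_coe_finset] at h
  obtain ⟨γ, hγ⟩ := exists_switching_of_orientation e
    (by simpa using hcount (fun _ => True) inferInstance)
    (hcount (fun i => i = 0) inferInstance)
  exact ⟨γ, fun i j => (harc i j).trans (hγ i j)⟩

theorem zmod_two_eq_add_one {a b : ZMod 2} (h : a ≠ b) : b = a + 1 := by
  revert a b
  decide

theorem zmod_two_two : (2 : ZMod 2) = 0 := rfl

/-- Pushable homomorphisms of a bipartite oriented graph to an unbalanced 4-cycle are colourings
of a signed graph. -/
theorem pushablyColorable_iff {U : Type*} {C : OrientedGraph (Fin 4)}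
    (hC : C.IsUnbalancedFourCycle) (K : OrientedGraph U) (c : U → ZMod 2)
    (hc : ∀ u v, K.Arc u v → c u ≠ c v) :
    K.PushablyColorable C ↔
      ∃ φ : U → Color, ∀ u v, K.Arc u v → Compatible (c u) (φ u) (φ v) := by
  classical
  obtain ⟨γ, hγ⟩ := exists_switching hC
  constructor
  · rintro ⟨f, K', ⟨S, rfl⟩, hf⟩
    let q : U → ZMod 2 := fun u => if u ∈ S then 1 else 0
    -- Here `f` may exchange the two classes on some components. The term `c u * (c u + part (f u))`
    -- corrects this: there it adds 1 at one end of each edge, and elsewhere it vanishes.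
    refine ⟨fun u => (pos (f u), γ (f u) + q u + c u * (c u + part (f u))), fun u v huv => ?_⟩
    have hcv := zmod_two_eq_add_one (hc u v huv)
    have key : part (f v) = part (f u) + 1 ∧
        γ (f u) + γ (f v) + pos (f u) * pos (f v) + q u + q v = part (f u) := by
      by_cases hS : u ∈ S ↔ v ∈ S
      · obtain ⟨h1, h2⟩ := (hγ _ _).1 (hf u v (Or.inl ⟨hS, huv⟩))
        have hq : q u = q v := by simp [q, hS]
        exact ⟨zmod_two_eq_add_one h1, by rw [h2, hq, add_assoc, zmod_two_add_self, add_zero]⟩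
      · obtain ⟨h1, h2⟩ := (hγ _ _).1 (hf v u (Or.inr ⟨fun h => hS h.symm, huv⟩))
        have hq : q v = q u + 1 := zmod_two_eq_add_one (by
          by_cases h1 : u ∈ S <;> by_cases h2 : v ∈ S <;> simp_all [q])
        have hp := zmod_two_eq_add_one h1.symm
        refine ⟨hp, ?_⟩
        have h3 : γ (f u) + γ (f v) + pos (f u) * pos (f v) = part (f u) + 1 := by
          rw [← hp, ← h2]; ring
        rw [h3, hq]
        generalize part (f u) = a
        generalize q u = b
        revert a b
        decide
    unfold Compatible
    simp only
    rw [hcv, key.1]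
    have h2 := key.2
    linear_combination h2 + (1 + c u * c u + c u * part (f u) + c u + part (f u)) * zmod_two_two
  · rintro ⟨φ, hφ⟩
    -- The class and the first coordinate locate the image; a vertex is pushed when its second
    -- coordinate differs from the `γ` of its image.
    let f : U → Fin 4 := fun u => corner (c u) (φ u).1
    let q : U → ZMod 2 := fun u => (φ u).2 + γ (f u)
    refine ⟨f, _, ⟨{u | q u = 1}, rfl⟩, fun u v huv => ?_⟩
    have hq : ∀ u v, (u ∈ {u | q u = 1} ↔ v ∈ {u | q u = 1}) ↔ q u = q v := by
      intro u v
      simp only [Set.mem_ofPred_eq]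
      generalize q u = a
      generalize q v = b
      revert a b
      decide
    rw [hγ]
    simp only [f, part_corner, pos_corner]
    rcases huv with ⟨h1, h2⟩ | ⟨h1, h2⟩
    · rw [hq] at h1
      refine ⟨hc _ _ h2, ?_⟩
      have h3 := hφ u v h2
      unfold Compatible at h3
      simp only [q, f] at h1
      linear_combination h3 + h1 - ((φ u).2 - γ (corner (c v) (φ v).1)) * zmod_two_two
    · rw [hq] at h1
      refine ⟨(hc _ _ h2).symm, ?_⟩
      have h3 := hφ v u h2
      have h4 := zmod_two_eq_add_one (hc _ _ h2)
      have h5 := zmod_two_eq_add_one h1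
      unfold Compatible at h3
      simp only [q, f] at h5
      linear_combination h3 + h5 - h4 - ((φ v).2 - γ (corner (c u) (φ u).1)) * zmod_two_two

variable {V : Type*}

open Classical in
/-- The signs of the edges of an oriented graph with a given bipartition. -/
noncomputable def edgeSign (G : OrientedGraph V) (c : V → ZMod 2) (u v : V) : ZMod 2 :=
  if G.Arc u v then c u else if G.Arc v u then c v else 0

theorem edgeSign_of_arc {G : OrientedGraph V} {c : V → ZMod 2} {u v : V} (h : G.Arc u v) :
    edgeSign G c u v = c u := by
  simp [edgeSign, h]

theorem edgeSign_comm (G : OrientedGraph V) (c : V → ZMod 2) (u v : V) :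
    edgeSign G c u v = edgeSign G c v u := by
  unfold edgeSign
  by_cases h1 : G.Arc u v
  · simp [h1, G.asymm u v h1]
  · by_cases h2 : G.Arc v u <;> simp [h1, h2]

theorem isCritical_underlying {C : OrientedGraph (Fin 4)} (hC : C.IsUnbalancedFourCycle)
    {G : OrientedGraph V} {c : V → ZMod 2} (hc : ∀ u v, G.Arc u v → c u ≠ c v)
    (h : G.IsPushableCritical C) : IsCritical G.underlying (edgeSign G c) := by
  classical
  refine ⟨fun ⟨φ, hφ⟩ => h.1 ((pushablyColorable_iff hC G c hc).2 ⟨φ, fun u v huv => ?_⟩),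
    fun A hA => ?_⟩
  · rw [← edgeSign_of_arc (c := c) huv]
    exact hφ u (Set.mem_univ u) v (Set.mem_univ v) (Or.inl huv)
  · let K : OrientedGraph A := ⟨fun u v => G.Arc u v, fun u v => G.asymm u v⟩
    obtain ⟨φ, hφ⟩ := (pushablyColorable_iff hC K (fun u => c u) fun u v huv => hc u v huv).1
      (h.2 A K ⟨fun _ _ huv => huv, Or.inl hA⟩)
    refine ⟨fun v => if hv : v ∈ A then φ ⟨v, hv⟩ else (0, 0), fun u hu v hv huv => ?_⟩
    simp only [hu, hv, dif_pos]
    rcases huv with huv | huv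
    · rw [edgeSign_of_arc huv]
      exact hφ ⟨u, hu⟩ ⟨v, hv⟩ huv
    · rw [edgeSign_comm, edgeSign_of_arc huv]
      exact (hφ ⟨v, hv⟩ ⟨u, hu⟩ huv).symm

theorem sum_deg_underlying [Fintype V] (G : OrientedGraph V) :
    ∑ v, deg G.underlying v = 2 * G.numArcs := by
  classical
  have h1 : ∀ R : V → V → Prop, {p : V × V | R p.1 p.2}.ncard =
      ∑ v, (nbrs R Finset.univ v).card := by
    intro R
    have : {p : V × V | R p.1 p.2} =
        ((Finset.univ.filter fun p : V × V => R p.1 p.2 : Finset (V × V)) : Set (V × V)) := by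
      ext p; simp
    rw [this, Set.ncard_coe_finset, Finset.card_filter, ← Finset.univ_product_univ,
      Finset.sum_product]
    refine Finset.sum_congr rfl fun v _ => ?_
    rw [← Finset.card_filter]
    congr 1
  have h2 : ∑ v, (nbrs G.Arc Finset.univ v).card =
      ∑ v, (nbrs (fun a b => G.Arc b a) Finset.univ v).card := by
    rw [← h1, ← h1]
    refine Set.ncard_congr (fun p _ => p.swap) (fun p hp => hp) (fun p q _ _ h => ?_)
      fun p hp => ⟨p.swap, hp, by simp⟩
    exact Prod.swap_injective h
  have h3 : ∀ v, deg G.underlying v = (nbrs G.Arc Finset.univ v).card +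
      (nbrs (fun a b => G.Arc b a) Finset.univ v).card := by
    intro v
    rw [deg, ← Finset.card_union_of_disjoint]
    · congr 1
      ext x
      simp [mem_nbrs, underlying]
    · rw [Finset.disjoint_left]
      exact fun x hx hx' => G.asymm _ _ (mem_nbrs.1 hx).2 (mem_nbrs.1 hx').2
  rw [Finset.sum_congr rfl fun v _ => h3 v, Finset.sum_add_distrib, ← h2, numArcs, h1, two_mul]

end SignedColoring

/-! ### Recognising the exceptional graph -/

namespace SignedColoring

open OrientedGraph

theorem clash_of_compatible {τ τ' : ZMod 2} {c d d' : Color} (h : Compatible τ c d)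
    (h' : Compatible τ' c d') (hd : d.1 = d'.1) : Clash (τ + τ') d d' := by
  refine ⟨hd, ?_⟩
  unfold Compatible at h h'
  rw [hd] at h
  linear_combination h + h' - (c.2 + c.1 * d'.1) * zmod_two_two

variable {V : Type*}

theorem push_arc_iff {G : OrientedGraph V} {c : V → ZMod 2} (hc : ∀ u v, G.Arc u v → c u ≠ c v)
    (q : V → ZMod 2) {u v : V} (huv : G.underlying.Adj u v) :
    (G.push {x | q x = 1}).Arc u v ↔ edgeSign G c u v + q u + q v = c u := by
  have hq : (u ∈ {x | q x = 1} ↔ v ∈ {x | q x = 1}) ↔ q u = q v := by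
    simp only [Set.mem_ofPred_eq]
    generalize q u = a
    generalize q v = b
    revert a b
    decide
  simp only [push, hq]
  rcases huv with h | h
  · rw [edgeSign_of_arc h]
    have h' := G.asymm u v h
    simp only [h, h', and_true, and_false, or_false]
    generalize q u = a
    generalize q v = b
    generalize c u = z
    revert a b z
    decide
  · rw [edgeSign_comm, edgeSign_of_arc h, zmod_two_eq_add_one (hc _ _ h).symm]
    have h' := G.asymm v u h
    simp only [h, h', and_true, and_false, false_or]
    generalize q u = a
    generalize q v = b
    generalize c u = z
    revert a b z
    decide

variable [Fintype V]

/-- If two neighbours of `w` share a first coordinate, the sum of their second coordinates is the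
sum of their signs to `w`, which is exactly the clash value of their midpoint. So three elements of
`ZMod 2` would be pairwise distinct. -/
theorem IsConfig.not_colorableOn {G : SimpleGraph V} {σ : V → V → ZMod 2}
    {w u₁ u₂ u₃ m₁₂ m₁₃ m₂₃ : V} (h : IsConfig G σ w u₁ u₂ u₃ m₁₂ m₁₃ m₂₃) :
    ¬ ColorableOn G σ {w, m₁₂, m₂₃, m₁₃, u₁, u₂, u₃} := by
  rintro ⟨φ, hφ⟩
  have hpair : ∀ u v m, u ∈ ({w, m₁₂, m₂₃, m₁₃, u₁, u₂, u₃} : Set V) →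
      v ∈ ({w, m₁₂, m₂₃, m₁₃, u₁, u₂, u₃} : Set V) →
      m ∈ ({w, m₁₂, m₂₃, m₁₃, u₁, u₂, u₃} : Set V) → G.Adj w u → G.Adj w v →
      m ∈ midpoints G u v → σ m u + σ m v + 1 = σ w u + σ w v → (φ u).1 ≠ (φ v).1 := by
    intro u v m hu hv hm hwu hwv hmid hs heq
    rw [mem_midpoints] at hmid
    have hw : w ∈ ({w, m₁₂, m₂₃, m₁₃, u₁, u₂, u₃} : Set V) := by simp
    have h1 := not_clash_of_compatible (hφ m hm u hu hmid.2.1.symm) (hφ m hm v hv hmid.2.2.symm)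
    rw [hs] at h1
    exact h1 (clash_of_compatible (hφ w hw u hu hwu) (hφ w hw v hv hwv) heq)
  have h12 := hpair u₁ u₂ m₁₂ (by simp) (by simp) (by simp) h.adj1 h.adj2 h.mem12 h.sign12
  have h13 := hpair u₁ u₃ m₁₃ (by simp) (by simp) (by simp) h.adj1 h.adj3 h.mem13 h.sign13
  have h23 := hpair u₂ u₃ m₂₃ (by simp) (by simp) (by simp) h.adj2 h.adj3 h.mem23 h.sign23
  have key : ∀ a b c : ZMod 2, a ≠ b → a ≠ c → b ≠ c → False := by decide
  exact key _ _ _ h12 h13 h23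

instance : DecidableRel exceptionalW.Arc := fun a b =>
  inferInstanceAs (Decidable ((a, b) ∈ (_ : Finset (Fin 7 × Fin 7))))

/-- All but three pairs of vertices in different parts of the exceptional graph are adjacent. -/
theorem exceptionalW_arc_or_arc (i j : Fin 7) (hij : (i.val < 4) ↔ ¬ (j.val < 4)) :
    exceptionalW.Arc i j ∨ exceptionalW.Arc j i ∨ (i = 1 ∧ j = 6) ∨ (i = 6 ∧ j = 1) ∨
      (i = 2 ∧ j = 4) ∨ (i = 4 ∧ j = 2) ∨ (i = 3 ∧ j = 5) ∨ (i = 5 ∧ j = 3) := by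
  revert i j
  decide

theorem exceptionalW_arc_iff (i j : Fin 7) : exceptionalW.Arc i j ↔
    (i = 0 ∧ j = 4) ∨ (i = 0 ∧ j = 5) ∨ (i = 0 ∧ j = 6) ∨ (i = 4 ∧ j = 1) ∨ (i = 1 ∧ j = 5) ∨
      (i = 5 ∧ j = 2) ∨ (i = 2 ∧ j = 6) ∨ (i = 3 ∧ j = 4) ∨ (i = 6 ∧ j = 3) := by
  revert i j
  decide

/-- A critical oriented graph with the exceptional configuration is the exceptional graph, up to
pushing vertices. -/
theorem IsConfig.exists_isomorphic {G : OrientedGraph V} {c : V → ZMod 2}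
    (hc : ∀ u v, G.Arc u v → c u ≠ c v)
    (hcrit : IsCritical G.underlying (edgeSign G c)) {w u₁ u₂ u₃ m₁₂ m₁₃ m₂₃ : V}
    (h : IsConfig G.underlying (edgeSign G c) w u₁ u₂ u₃ m₁₂ m₁₃ m₂₃) :
    ∃ G', G.PushEquivalent G' ∧ G'.Isomorphic exceptionalW := by
  have hcadj : ∀ u v, G.underlying.Adj u v → c v = c u + 1 := by
    rintro u v (huv | huv)
    · exact zmod_two_eq_add_one (hc _ _ huv)
    · exact zmod_two_eq_add_one (hc _ _ huv).symm
  obtain ⟨d12, a12, b12⟩ := mem_midpoints.1 h.mem12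
  obtain ⟨d13, a13, b13⟩ := mem_midpoints.1 h.mem13
  obtain ⟨d23, a23, b23⟩ := mem_midpoints.1 h.mem23
  have cu1 := hcadj _ _ h.adj1
  have cu2 := hcadj _ _ h.adj2
  have cu3 := hcadj _ _ h.adj3
  have two : ∀ a : ZMod 2, a + 1 + 1 = a := by decide
  have cm12 : c m₁₂ = c w := by rw [hcadj _ _ a12, cu1, two]
  have cm13 : c m₁₃ = c w := by rw [hcadj _ _ a13, cu1, two]
  have cm23 : c m₂₃ = c w := by rw [hcadj _ _ a23, cu2, two]
  have n12 : ¬ G.underlying.Adj m₁₂ u₃ := fun hh =>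
    (adj_of_deg_eq_two d12 a12.symm b12.symm h.ne12 hh).elim h.ne13.symm h.ne23.symm
  have n13 : ¬ G.underlying.Adj m₁₃ u₂ := fun hh =>
    (adj_of_deg_eq_two d13 a13.symm b13.symm h.ne13 hh).elim h.ne12.symm h.ne23
  have n23 : ¬ G.underlying.Adj m₂₃ u₁ := fun hh =>
    (adj_of_deg_eq_two d23 a23.symm b23.symm h.ne23 hh).elim h.ne12 h.ne13
  let g : Fin 7 → V := ![w, m₁₂, m₂₃, m₁₃, u₁, u₂, u₃]
  have hsurj : Function.Surjective g := by
    -- A proper subset would be colourable by criticality.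
    have huniv : ({w, m₁₂, m₂₃, m₁₃, u₁, u₂, u₃} : Set V) = Set.univ := by
      by_contra hne
      exact h.not_colorableOn (hcrit.colorable _ hne)
    intro v
    have hv : v ∈ ({w, m₁₂, m₂₃, m₁₃, u₁, u₂, u₃} : Set V) := huniv ▸ Set.mem_univ v
    simp only [Set.mem_insert_iff, Set.mem_singleton_iff] at hv
    rcases hv with rfl | rfl | rfl | rfl | rfl | rfl | rfl
    exacts [⟨0, rfl⟩, ⟨1, rfl⟩, ⟨2, rfl⟩, ⟨3, rfl⟩, ⟨4, rfl⟩, ⟨5, rfl⟩, ⟨6, rfl⟩]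
  have hcg : ∀ i, c (g i) = c w + if i.val < 4 then 0 else 1 := by
    intro i
    fin_cases i <;> simp [g, cm12, cm13, cm23, cu1, cu2, cu3]
  have hinj : Function.Injective g := by
    have hw : ∀ m, deg G.underlying m = 2 → w ≠ m := fun m hm hwm => by
      have := h.degw
      rw [hwm] at this
      omega
    have e1 : m₁₂ ≠ m₁₃ := fun hh => n12 (hh ▸ b13.symm)
    have e2 : m₁₂ ≠ m₂₃ := fun hh => n12 (hh ▸ b23.symm)
    have e3 : m₁₃ ≠ m₂₃ := fun hh => n13 (hh ▸ a23.symm)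
    intro i j hij
    have hpart : (i.val < 4) ↔ (j.val < 4) := by
      have h1 := hcg i
      rw [hij, hcg j] at h1
      have h2 := add_left_cancel h1
      by_cases hi : i.val < 4 <;> by_cases hj : j.val < 4 <;>
        simp only [hi, hj, if_true, if_false] at h2 ⊢
      · exact absurd h2 (by decide)
      · exact absurd h2 (by decide)
    have hpm12 := hw _ d12
    have hpm13 := hw _ d13
    have hpm23 := hw _ d23
    have f1 := h.ne12
    have f2 := h.ne13
    have f3 := h.ne23
    fin_cases i <;> fin_cases j <;> first
      | rfl
      | exact absurd hpart (by decide)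
      | exact absurd hij (by first | assumption | exact Ne.symm (by assumption))
  let e : V ≃ Fin 7 := (Equiv.ofBijective g ⟨hinj, hsurj⟩).symm
  have heg : ∀ i, e (g i) = i := fun i => (Equiv.ofBijective g ⟨hinj, hsurj⟩).symm_apply_apply i
  have hge : ∀ v, g (e v) = v := fun v => (Equiv.ofBijective g ⟨hinj, hsurj⟩).apply_symm_apply v
  let σ := edgeSign G c
  -- With `Q` zero at `w`, the arcs out of `w` determine `Q` at the `uᵢ`, and the arc out of each
  -- midpoint determines `Q` there. The arc into each midpoint is then correct by the sign
  -- conditions.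
  let Q : Fin 7 → ZMod 2 := ![0, σ m₁₂ u₂ + σ w u₂, σ m₂₃ u₃ + σ w u₃, σ m₁₃ u₁ + σ w u₁,
    σ w u₁ + c w, σ w u₂ + c w, σ w u₃ + c w]
  let q : V → ZMod 2 := fun v => Q (e v)
  have hq : ∀ i, q (g i) = Q i := fun i => by simp only [q, heg]
  have hforward : ∀ i j, exceptionalW.Arc i j →
      (G.push {x | q x = 1}).Arc (g i) (g j) := by
    have s12 : σ m₁₂ u₁ + σ m₁₂ u₂ + 1 = σ w u₁ + σ w u₂ := h.sign12
    have s13 : σ m₁₃ u₁ + σ m₁₃ u₃ + 1 = σ w u₁ + σ w u₃ := h.sign13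
    have s23 : σ m₂₃ u₂ + σ m₂₃ u₃ + 1 = σ w u₂ + σ w u₃ := h.sign23
    have harc : ∀ i j, G.underlying.Adj (g i) (g j) →
        (σ (g i) (g j) + Q i + Q j = c (g i)) → (G.push {x | q x = 1}).Arc (g i) (g j) := by
      intro i j hadj heq
      rw [push_arc_iff hc q hadj, hq, hq]
      exact heq
    intro i j hij
    rw [exceptionalW_arc_iff] at hij
    rcases hij with ⟨rfl, rfl⟩ | ⟨rfl, rfl⟩ | ⟨rfl, rfl⟩ | ⟨rfl, rfl⟩ | ⟨rfl, rfl⟩ | ⟨rfl, rfl⟩ |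
      ⟨rfl, rfl⟩ | ⟨rfl, rfl⟩ | ⟨rfl, rfl⟩
    · refine harc _ _ h.adj1 ?_
      change σ w u₁ + 0 + (σ w u₁ + c w) = c w
      linear_combination σ w u₁ * zmod_two_two
    · refine harc _ _ h.adj2 ?_
      change σ w u₂ + 0 + (σ w u₂ + c w) = c w
      linear_combination σ w u₂ * zmod_two_two
    · refine harc _ _ h.adj3 ?_
      change σ w u₃ + 0 + (σ w u₃ + c w) = c w
      linear_combination σ w u₃ * zmod_two_two
    · refine harc _ _ a12 ?_
      change σ u₁ m₁₂ + (σ w u₁ + c w) + (σ m₁₂ u₂ + σ w u₂) = c u₁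
      rw [show σ u₁ m₁₂ = σ m₁₂ u₁ from edgeSign_comm _ _ _ _, cu1]
      linear_combination s12 + (σ w u₁ + σ w u₂ - 1) * zmod_two_two
    · refine harc _ _ b12.symm ?_
      change σ m₁₂ u₂ + (σ m₁₂ u₂ + σ w u₂) + (σ w u₂ + c w) = c m₁₂
      rw [cm12]
      linear_combination (σ m₁₂ u₂ + σ w u₂) * zmod_two_two
    · refine harc _ _ a23 ?_
      change σ u₂ m₂₃ + (σ w u₂ + c w) + (σ m₂₃ u₃ + σ w u₃) = c u₂
      rw [show σ u₂ m₂₃ = σ m₂₃ u₂ from edgeSign_comm _ _ _ _, cu2]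
      linear_combination s23 + (σ w u₂ + σ w u₃ - 1) * zmod_two_two
    · refine harc _ _ b23.symm ?_
      change σ m₂₃ u₃ + (σ m₂₃ u₃ + σ w u₃) + (σ w u₃ + c w) = c m₂₃
      rw [cm23]
      linear_combination (σ m₂₃ u₃ + σ w u₃) * zmod_two_two
    · refine harc _ _ a13.symm ?_
      change σ m₁₃ u₁ + (σ m₁₃ u₁ + σ w u₁) + (σ w u₁ + c w) = c m₁₃
      rw [cm13]
      linear_combination (σ m₁₃ u₁ + σ w u₁) * zmod_two_two
    · refine harc _ _ b13 ?_
      change σ u₃ m₁₃ + (σ w u₃ + c w) + (σ m₁₃ u₁ + σ w u₁) = c u₃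
      rw [show σ u₃ m₁₃ = σ m₁₃ u₃ from edgeSign_comm _ _ _ _, cu3]
      linear_combination s13 + (σ w u₁ + σ w u₃ - 1) * zmod_two_two
  -- No further arcs exist: pairs within a class are excluded by the bipartition, and the three
  -- remaining pairs by the degree two of the midpoints.
  have hbackward : ∀ i j, (G.push {x | q x = 1}).Arc (g i) (g j) → exceptionalW.Arc i j := by
    intro i j hij
    have hadj : G.underlying.Adj (g i) (g j) := by
      rcases hij with ⟨-, hij⟩ | ⟨-, hij⟩
      exacts [Or.inl hij, Or.inr hij]
    have hpart : (i.val < 4) ↔ ¬ (j.val < 4) := by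
      have h1 := hcadj _ _ hadj
      rw [hcg, hcg, add_assoc] at h1
      have h2 := add_left_cancel h1
      by_cases hi : i.val < 4 <;> by_cases hj : j.val < 4 <;> simp only [hi, hj, if_true, if_false]
        at h2 ⊢
      · exact absurd h2 (by decide)
      · simp
      · simp
      · exact absurd h2 (by decide)
    rcases exceptionalW_arc_or_arc i j hpart with hW | hW | ⟨rfl, rfl⟩ | ⟨rfl, rfl⟩ | ⟨rfl, rfl⟩ |
      ⟨rfl, rfl⟩ | ⟨rfl, rfl⟩ | ⟨rfl, rfl⟩
    · exact hW
    · exact absurd hij (OrientedGraph.asymm _ _ _ (hforward j i hW))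
    · exact absurd hadj n12
    · exact absurd hadj.symm n12
    · exact absurd hadj n23
    · exact absurd hadj.symm n23
    · exact absurd hadj n13
    · exact absurd hadj.symm n13
  refine ⟨_, ⟨{x | q x = 1}, rfl⟩, e, fun u v => ?_⟩
  constructor
  · intro huv
    exact hbackward _ _ (by rwa [hge, hge])
  · intro huv
    have := hforward _ _ huv
    rwa [hge, hge] at this

end SignedColoring

theorem mainTheorem10 {V : Type*} [Fintype V]
    (C : OrientedGraph (Fin 4)) (hC : C.IsUnbalancedFourCycle)
    (G : OrientedGraph V) (hbip : G.underlying.IsBipartite)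
    (hcrit : G.IsPushableCritical C)
    (hW : ∀ G' : OrientedGraph V, G.PushEquivalent G' →
      ¬ G'.Isomorphic OrientedGraph.exceptionalW) :
    (4 * (Fintype.card V : ℚ)) / 3 ≤ (G.numArcs : ℚ) := by
  classical
  obtain ⟨c⟩ := hbip
  have hc : ∀ u v, G.Arc u v → (c u : ZMod 2) ≠ c v := fun u v huv => c.valid (Or.inl huv)
  have hcr := SignedColoring.isCritical_underlying (c := fun v => (c v : ZMod 2)) hC hc hcrit
  rcases hcr.le_sum_deg_or_isConfig (SignedColoring.edgeSign_comm _ _) with h | h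
  · rw [SignedColoring.sum_deg_underlying] at h
    have h' : (8 : ℚ) * Fintype.card V ≤ 3 * (2 * G.numArcs) := by exact_mod_cast h
    linarith
  · obtain ⟨w, u₁, u₂, u₃, m₁₂, m₁₃, m₂₃, hconf⟩ := h
    obtain ⟨G', h1, h2⟩ := hconf.exists_isomorphic hc hcr
    exact absurd h2 (hW G' h1)
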